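/- For a mapping $\varphi:\{1,\dots,n\}\to\{1,\dots,n\}$ chosen uniformly at random among all $n^n$ mappings, let $N$ be the number of cyclic points of $\varphi$ (points $x$ with $\varphi^k(x)=x$ for some $k\ge1$), and let $\Lambda_r$ be the length of the $r$-th longest cycle of $\varphi$ (cycles ranked by length with multiplicity; $\Lambda_r=0$ if $\varphi$ has fewer than $r$ cycles). There are unique functions $\rho_1,\rho_2,\dots:\mathbb{R}\to\mathbb{R}$, vanishing on $(-\infty,0)$, equal to $1$ on $[0,1]$, continuous on $[0,\infty)$ and differentiable on $(1,\infty)$, such that for all $\xi>1$ $$\xi\rho_1'(\xi)+\rho_1(\xi-1)=0,\qquad \xi\rho_r'(\xi)+\rho_r(\xi-1)=\rho_{r-1}(\xi-1)\quad(r\ge2)$$ ($\rho_1$ is Dickman's function). For every $r\ge2$ put $$f_r(\lambda,\nu)=\frac{\nu}{\lambda}\,e^{-\nu^2/2}\left[\rho_r\!\left(\frac{\nu-\lambda}{\lambda}\right)-\rho_{r-1}\!\left(\frac{\nu-\lambda}{\lambda}\right)\right]\quad\text{for }0<\lambda<\nu<\infty,$$ and $f_r(\lambda,\nu)=0$ otherwise.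 Then $f_r$ is the limiting joint density of $(\Lambda_r,N)$ on the scale $\sqrt n$: $f_r$ is measurable and nonnegative, it is the density with respect to Lebesgue measure of a probability measure on $\mathbb{R}^2$, and the pair $(\Lambda_r/\sqrt n,\;N/\sqrt n)$ converges in distribution to this measure as $n\to\infty$. -/

import Mathlib

open MeasureTheory ProbabilityTheory Filter Topology

noncomputable section

namespace RandomMapping

/-- The finite set of cyclic points of a self-map of a finite type. -/
def cyclicPoints {α : Type*} [Fintype α] (φ : α → α) : Finset α :=
  open Classical in Finset.univ.filter (fun x => x ∈ Function.periodicPts φ)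

/-- The finite set of the distinct cycles of `φ`. A cycle is a cyclically ordered list
`[x, φ x, φ (φ x), …]` up to rotation, so cyclic points on the same loop give the same element. -/
def cycles {α : Type*} [Fintype α] (φ : α → α) : Finset (Cycle α) :=
  open Classical in (cyclicPoints φ).image (Function.periodicOrbit φ)

/-- The lengths of the cycles of `φ`, with multiplicity, in non-increasing order. -/
def cycleLengths {α : Type*} [Fintype α] (φ : α → α) : List ℕ :=
  ((cycles φ).val.map Cycle.length).sort (fun a b => b ≤ a)

/-- The length of the `r`-th longest cycle (`r = 1` is the longest one); it is `0` if there are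
fewer than `r` cycles. -/
def rthLongestCycle {α : Type*} [Fintype α] (r : ℕ) (φ : α → α) : ℕ :=
  (cycleLengths φ).getD (r - 1) 0

/-- The uniform distribution on all maps from an `n`-element set to itself. -/
def uniformMapping (n : ℕ) : Measure (Fin n → Fin n) :=
  uniformOn Set.univ

instance (n : ℕ) : IsProbabilityMeasure (uniformMapping n) :=
  isProbabilityMeasure_uniformOn Set.finite_univ ⟨id, Set.mem_univ _⟩

/-- The pair `(Λ_r / √n, N / √n)`. -/
def scaledPair (r n : ℕ) (φ : Fin n → Fin n) : ℝ × ℝ :=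
  ((rthLongestCycle r φ : ℝ) / √(n : ℝ), ((cyclicPoints φ).card : ℝ) / √(n : ℝ))

/-- `u` is the continuous solution on `[0, ∞)` of `ξ u'(ξ) + u(ξ - 1) = g(ξ - 1)` for `ξ > 1`,
with `u = 1` on `[0, 1]`, extended by `0` to the negative half-line. -/
structure SolvesDelayEquation (g u : ℝ → ℝ) : Prop where
  eq_zero_of_neg : ∀ ξ < 0, u ξ = 0
  eq_one : ∀ ξ, 0 ≤ ξ → ξ ≤ 1 → u ξ = 1
  continuousOn : ContinuousOn u (Set.Ici 0)
  differentiableAt : ∀ ξ > 1, DifferentiableAt ℝ u ξ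
  delay : ∀ ξ > 1, ξ * deriv u ξ + u (ξ - 1) = g (ξ - 1)

/-- `ρ 1, ρ 2, …` are the generalized Dickman functions: `ρ 1` is Dickman's function, and `ρ r`
is obtained from `ρ (r - 1)` by the delay equation. The index `0` is not used in the mathematics
and is filled with the zero function. -/
structure IsGeneralizedDickman (ρ : ℕ → ℝ → ℝ) : Prop where
  zero : ρ 0 = 0
  dickman : SolvesDelayEquation 0 (ρ 1)
  step : ∀ r ≥ 2, SolvesDelayEquation (ρ (r - 1)) (ρ r)

/-- The function `f_r(λ, ν)`, supported on `0 < λ < ν`. -/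
def jointDensity (ρ : ℕ → ℝ → ℝ) (r : ℕ) (l ν : ℝ) : ℝ :=
  if 0 < l ∧ l < ν then
    ν / l * Real.exp (-ν ^ 2 / 2) * (ρ r ((ν - l) / l) - ρ (r - 1) ((ν - l) / l))
  else 0

end RandomMapping

end

/-! A map is determined by its set `S` of cyclic points, a permutation of `S`, and a forest with set
of roots `S`. The number of forests depends only on the size of `S`. So, given `N = k`, the
permutation is uniform, and the probability that `N = k` and `Λ_r ≤ m` is the product of `cyclicProb
n k` and `permProb r m k`, where `permProb r m k` is the probability that a uniform permutation of
`k` points has fewer than `r` cycles longer than `m` (`card_rthLongestCycle_le`).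

The forest factor is Cayley's formula (`forestCount_mul_card`). It gives `cyclicProb`, and for `k ~
ν√n` the product `√n * cyclicProb n k` tends to the Rayleigh density `ν exp(-ν²/2)`.

For the permutation factor, the cycle through a fixed point is removed. Its length is uniform, and a
long one uses up one of the permitted long cycles. Differencing the resulting recurrence gives
`permProb_sub`, which is an Euler scheme of step `1/m` for the delay equation. Hence `permProb r m k
= ρ_r(k/m) + O(1/m)` for `k/m` bounded (`IsGeneralizedDickman.exists_permProb_bound`). Bounds and
monotonicity of `ρ_r` are inherited from these probabilities.

Summing over `k` by dominated convergence, the probability that `Λ_r ≤ x√n` and `y₁√n < N ≤ y₂√n`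
tends to the integral over `(y₁, y₂]` of `ν exp(-ν²/2) ρ_r(ν/x)`. By the delay equation the
`x`-derivative of this integrand is `f_r(x, ν)`. The total mass is one because `ρ_r = 1` on `[0,
1]`, `ρ_r → 0` at infinity, and the Rayleigh density has mass one. Convergence on boxes in the open
quadrant, which has full limit mass, then gives weak convergence. -/

namespace RandomMapping

/-! ### The delay equation -/

/-- The integral operator whose fixed points solve the delay equation on `[0, ∞)`. The arguments are
truncated so that it maps continuous functions to continuous functions. -/
noncomputable def delayOperator (g v : ℝ → ℝ) (ξ : ℝ) : ℝ :=
  1 + ∫ t in (1 : ℝ)..max ξ 1, (g (max (t - 1) 0) - v (max (t - 1) 0)) / max t 1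

theorem continuous_delayIntegrand {g v : ℝ → ℝ} (hg : ContinuousOn g (Set.Ici 0))
    (hv : Continuous v) :
    Continuous fun t : ℝ => (g (max (t - 1) 0) - v (max (t - 1) 0)) / max t 1 := by
  have h1 : Continuous fun t : ℝ => g (max (t - 1) 0) :=
    hg.comp_continuous (by fun_prop) fun t => Set.mem_Ici.2 (le_max_right _ _)
  refine Continuous.div (h1.sub (hv.comp (by fun_prop))) (by fun_prop) fun t => ?_
  have : (1 : ℝ) ≤ max t 1 := le_max_right _ _
  positivity

theorem continuous_delayOperator {g v : ℝ → ℝ} (hg : ContinuousOn g (Set.Ici 0))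
    (hv : Continuous v) : Continuous (delayOperator g v) := by
  have h := intervalIntegral.continuous_primitive (μ := volume)
    (fun a b => (continuous_delayIntegrand hg hv).intervalIntegrable a b) 1
  exact continuous_const.add (h.comp (by fun_prop : Continuous fun ξ : ℝ => max ξ 1))

theorem delayOperator_of_le_one (g v : ℝ → ℝ) {ξ : ℝ} (h : ξ ≤ 1) : delayOperator g v ξ = 1 := by
  simp [delayOperator, max_eq_right h]

/-- The integrand at `t` looks at `v` only at `t - 1`, so agreement is propagated one unit to the
right. This is the method of steps. -/
theorem delayOperator_congr (g : ℝ → ℝ) {v w : ℝ → ℝ} {T : ℝ} (h0 : 0 ≤ T)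
    (h : ∀ ξ ≤ T, v ξ = w ξ) {ξ : ℝ} (hξ : ξ ≤ T + 1) :
    delayOperator g v ξ = delayOperator g w ξ := by
  unfold delayOperator
  congr 1
  refine intervalIntegral.integral_congr fun t ht => ?_
  rw [Set.uIcc_of_le (le_max_right _ _)] at ht
  have h2 : t ≤ T + 1 := ht.2.trans (max_le hξ (by linarith))
  rw [h _ (max_le (by linarith) h0)]

/-- The starting function is already correct up to `1`, and every application gains one unit, so the
iterates stabilise on each half-line `ξ ≤ j + 1`. -/
theorem delayOperator_iterate_eq (g : ℝ → ℝ) (j : ℕ) {ξ : ℝ} (hξ : ξ ≤ j + 1) :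
    (delayOperator g)^[j + 1] (fun _ => 1) ξ = (delayOperator g)^[j] (fun _ => 1) ξ := by
  induction j generalizing ξ with
  | zero => simpa using delayOperator_of_le_one g _ (by simpa using hξ)
  | succ j ih =>
    rw [Function.iterate_succ_apply' _ (j + 1)]
    nth_rw 2 [Function.iterate_succ_apply']
    exact delayOperator_congr g (T := j + 1) (by positivity) (fun ξ h => ih h) (by exact_mod_cast hξ)

theorem delayOperator_iterate_eq_of_le (g : ℝ → ℝ) {i j : ℕ} (hij : i ≤ j) {ξ : ℝ}
    (hξ : ξ ≤ i + 1) :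
    (delayOperator g)^[j] (fun _ => 1) ξ = (delayOperator g)^[i] (fun _ => 1) ξ := by
  induction j, hij using Nat.le_induction with
  | base => rfl
  | succ j hj ih =>
    rw [delayOperator_iterate_eq g j (hξ.trans (by gcongr)), ih]

/-- The fixed point of `delayOperator g`, obtained by the method of steps. -/
noncomputable def delayLimit (g : ℝ → ℝ) (ξ : ℝ) : ℝ := (delayOperator g)^[⌈ξ⌉₊] (fun _ => 1) ξ

theorem delayLimit_eq (g : ℝ → ℝ) {j : ℕ} {ξ : ℝ} (hξ : ξ ≤ j + 1) :
    delayLimit g ξ = (delayOperator g)^[j] (fun _ => 1) ξ := by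
  have h1 : ξ ≤ (⌈ξ⌉₊ : ℝ) + 1 := (Nat.le_ceil ξ).trans (by simp)
  rcases le_total ⌈ξ⌉₊ j with h | h
  · exact (delayOperator_iterate_eq_of_le g h h1).symm
  · exact delayOperator_iterate_eq_of_le g h hξ

theorem delayLimit_fixed (g : ℝ → ℝ) (ξ : ℝ) :
    delayOperator g (delayLimit g) ξ = delayLimit g ξ := by
  obtain ⟨j, hj⟩ := exists_nat_ge ξ
  rw [delayLimit_eq g (j := j + 1) (by push_cast; linarith), Function.iterate_succ_apply']
  exact delayOperator_congr g (T := j + 1) (by positivity) (fun ξ h => delayLimit_eq g h)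
    (by linarith)

theorem continuous_delayLimit {g : ℝ → ℝ} (hg : ContinuousOn g (Set.Ici 0)) :
    Continuous (delayLimit g) := by
  have hc : ∀ j : ℕ, Continuous ((delayOperator g)^[j] (fun _ => 1)) := by
    intro j
    induction j with
    | zero => exact continuous_const
    | succ j ih =>
      rw [Function.iterate_succ_apply']
      exact continuous_delayOperator hg ih
  refine continuous_iff_continuousAt.2 fun ξ => ?_
  obtain ⟨j, hj⟩ := exists_nat_ge ξ
  refine (hc j).continuousAt.congr ?_
  filter_upwards [eventually_lt_nhds (show ξ < j + 1 by linarith)] with t ht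
  exact (delayLimit_eq g ht.le).symm

theorem hasDerivAt_delayLimit {g : ℝ → ℝ} (hg : ContinuousOn g (Set.Ici 0)) {ξ : ℝ}
    (hξ : 1 < ξ) :
    HasDerivAt (delayLimit g) ((g (ξ - 1) - delayLimit g (ξ - 1)) / ξ) ξ := by
  have hc := continuous_delayIntegrand hg (continuous_delayLimit hg)
  have h := (intervalIntegral.integral_hasDerivAt_right (hc.intervalIntegrable 1 ξ)
    (hc.stronglyMeasurableAtFilter _ _) hc.continuousAt).const_add 1
  rw [max_eq_left (by linarith), max_eq_left hξ.le] at h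
  refine h.congr_of_eventuallyEq ?_
  filter_upwards [eventually_gt_nhds hξ] with t ht
  rw [← delayLimit_fixed, delayOperator, max_eq_left ht.le]

/-- The solution of the delay equation with right-hand side `g`. -/
noncomputable def delaySolution (g : ℝ → ℝ) (ξ : ℝ) : ℝ := if ξ < 0 then 0 else delayLimit g ξ

theorem delaySolution_of_nonneg (g : ℝ → ℝ) {ξ : ℝ} (h : 0 ≤ ξ) :
    delaySolution g ξ = delayLimit g ξ := if_neg h.not_gt

theorem solvesDelayEquation_delaySolution {g : ℝ → ℝ} (hg : ContinuousOn g (Set.Ici 0)) :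
    SolvesDelayEquation g (delaySolution g) := by
  have hd : ∀ ξ > 1, HasDerivAt (delaySolution g) ((g (ξ - 1) - delayLimit g (ξ - 1)) / ξ) ξ := by
    intro ξ hξ
    refine (hasDerivAt_delayLimit hg hξ).congr_of_eventuallyEq ?_
    filter_upwards [eventually_gt_nhds hξ] with t ht
    exact delaySolution_of_nonneg g (by linarith)
  refine ⟨fun ξ h => if_pos h, fun ξ h0 h1 => ?_, ?_, fun ξ hξ => (hd ξ hξ).differentiableAt,
    fun ξ hξ => ?_⟩
  · rw [delaySolution_of_nonneg g h0, ← delayLimit_fixed, delayOperator_of_le_one g _ h1]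
  · exact (continuous_delayLimit hg).continuousOn.congr fun ξ h => delaySolution_of_nonneg g h
  · rw [(hd ξ hξ).deriv, delaySolution_of_nonneg g (by linarith : (0 : ℝ) ≤ ξ - 1)]
    have : ξ ≠ 0 := by linarith
    field_simp
    ring

theorem SolvesDelayEquation.hasDerivAt {g u : ℝ → ℝ} (h : SolvesDelayEquation g u) {ξ : ℝ}
    (hξ : 1 < ξ) : HasDerivAt u (-(u (ξ - 1) - g (ξ - 1)) / ξ) ξ := by
  have h1 := (h.differentiableAt ξ hξ).hasDerivAt
  have h2 := h.delay ξ hξ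
  have h3 : -(u (ξ - 1) - g (ξ - 1)) / ξ = deriv u ξ := by
    rw [div_eq_iff (by linarith)]
    linarith
  rwa [h3]

theorem SolvesDelayEquation.unique {g u w : ℝ → ℝ} (hu : SolvesDelayEquation g u)
    (hw : SolvesDelayEquation g w) : u = w := by
  have key : ∀ j : ℕ, ∀ ξ : ℝ, ξ ≤ j + 1 → u ξ = w ξ := by
    have base : ∀ ξ : ℝ, ξ ≤ 1 → u ξ = w ξ := by
      intro ξ hξ
      rcases lt_or_ge ξ 0 with h | h
      · rw [hu.eq_zero_of_neg _ h, hw.eq_zero_of_neg _ h]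
      · rw [hu.eq_one _ h hξ, hw.eq_one _ h hξ]
    intro j
    induction j with
    | zero => simpa using base
    | succ j ih =>
      intro ξ hξ
      rcases le_or_gt ξ 1 with h | h
      · exact base ξ h
      -- On `(1, ξ)` the delayed values agree by induction, so the difference has derivative zero
      -- there.
      obtain ⟨c, hc, hc'⟩ := exists_hasDerivAt_eq_slope (fun t => u t - w t) (fun _ => 0) h
        (((hu.continuousOn.sub hw.continuousOn).mono
          fun t ht => le_trans (by norm_num) ht.1)) (fun t ht => by
          have h3 := (hu.hasDerivAt ht.1).sub (hw.hasDerivAt ht.1)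
          rw [ih (t - 1) (by push_cast at hξ; linarith [ht.2]), sub_self] at h3
          exact h3)
      rw [eq_comm, div_eq_zero_iff] at hc'
      have h4 := base 1 le_rfl
      rcases hc' with h5 | h5
      · linarith
      · linarith
  funext ξ
  obtain ⟨j, hj⟩ := exists_nat_ge ξ
  exact key j ξ (by linarith)

/-- The recursively constructed sequence of generalized Dickman functions. -/
noncomputable def dickmanSeq : ℕ → ℝ → ℝ
  | 0 => 0
  | r + 1 => delaySolution (dickmanSeq r)

theorem continuousOn_dickmanSeq (r : ℕ) : ContinuousOn (dickmanSeq r) (Set.Ici 0) := by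
  induction r with
  | zero => exact continuousOn_const
  | succ r ih => exact (solvesDelayEquation_delaySolution ih).continuousOn

/-- With `ρ 0 = 0`, Dickman's equation is the first instance of the recursion, so inductions on `r`
can start from a trivial case. -/
theorem isGeneralizedDickman_iff {ρ : ℕ → ℝ → ℝ} :
    IsGeneralizedDickman ρ ↔ ρ 0 = 0 ∧ ∀ r, SolvesDelayEquation (ρ r) (ρ (r + 1)) := by
  constructor
  · rintro ⟨h0, h1, h2⟩
    refine ⟨h0, fun r => ?_⟩
    cases r with
    | zero => rw [h0]; exact h1
    | succ r => exact h2 (r + 2) (by omega)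
  · rintro ⟨h0, h1⟩
    refine ⟨h0, by simpa [h0] using h1 0, fun r hr => ?_⟩
    have := h1 (r - 1)
    rwa [Nat.sub_add_cancel (by omega)] at this

theorem existsUnique_isGeneralizedDickman : ∃! ρ : ℕ → ℝ → ℝ, IsGeneralizedDickman ρ := by
  refine ⟨dickmanSeq, isGeneralizedDickman_iff.2
    ⟨rfl, fun r => solvesDelayEquation_delaySolution (continuousOn_dickmanSeq r)⟩, fun ρ hρ => ?_⟩
  replace hρ := isGeneralizedDickman_iff.1 hρ
  funext r
  induction r with
  | zero => exact hρ.1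
  | succ r ih =>
    have h := hρ.2 r
    rw [ih] at h
    exact h.unique (solvesDelayEquation_delaySolution (continuousOn_dickmanSeq r))

theorem IsGeneralizedDickman.continuousOn {ρ : ℕ → ℝ → ℝ} (hρ : IsGeneralizedDickman ρ) (r : ℕ) :
    ContinuousOn (ρ r) (Set.Ici 0) := by
  rw [isGeneralizedDickman_iff] at hρ
  cases r with
  | zero => rw [hρ.1]; exact continuousOn_const
  | succ r => exact (hρ.2 r).continuousOn

/-- Solutions of the delay equation are Lipschitz on bounded subintervals of `[0, ∞)`. -/
theorem SolvesDelayEquation.exists_lipschitz {g u : ℝ → ℝ} (hu : SolvesDelayEquation g u)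
    (hg : ContinuousOn g (Set.Ici 0)) (T : ℝ) :
    ∃ K : ℝ, 0 ≤ K ∧ ∀ s t, 0 ≤ s → s ≤ t → t ≤ T → |u t - u s| ≤ K * (t - s) := by
  obtain ⟨K, hK⟩ := (isCompact_Icc (a := (0 : ℝ)) (b := T)).exists_bound_of_continuousOn
    ((hu.continuousOn.sub hg).mono Set.Icc_subset_Ici_self)
  -- Beyond `1` the derivative is `-(u - g)(ξ - 1) / ξ` with `ξ ≥ 1`, hence at most `K` in size. On
  -- `[0, 1]` the function is constant, and intervals crossing `1` are cut there.
  have main : ∀ s t, 1 ≤ s → s ≤ t → t ≤ T → |u t - u s| ≤ max K 0 * (t - s) := by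
    intro s t hs hst ht
    rcases hst.eq_or_lt with rfl | hst
    · simp
    obtain ⟨c, hc, hc'⟩ := exists_hasDerivAt_eq_slope u _ hst
      (hu.continuousOn.mono fun x hx => le_trans (by linarith) hx.1)
      (fun x hx => hu.hasDerivAt (hs.trans_lt hx.1))
    rw [eq_div_iff (by linarith)] at hc'
    rw [← hc', abs_mul, abs_of_pos (sub_pos.2 hst)]
    refine mul_le_mul_of_nonneg_right ?_ (by linarith)
    rw [abs_div, abs_neg]
    have h1 : (1 : ℝ) ≤ |c| := by rw [abs_of_pos] <;> linarith [hc.1]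
    have h2 := hK (c - 1) ⟨by linarith [hc.1], by linarith [hc.2]⟩
    rw [Real.norm_eq_abs] at h2
    exact (div_le_self (abs_nonneg _) h1).trans (h2.trans (le_max_left _ _))
  refine ⟨max K 0, le_max_right _ _, fun s t hs hst ht => ?_⟩
  have hK0 : 0 ≤ max K 0 := le_max_right _ _
  rcases le_or_gt 1 s with h1 | h1
  · exact main s t h1 hst ht
  rcases le_or_gt t 1 with h2 | h2
  · rw [hu.eq_one t (hs.trans hst) h2, hu.eq_one s hs h1.le, sub_self, abs_zero]
    exact mul_nonneg hK0 (by linarith)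
  · have h3 := main 1 t le_rfl h2.le ht
    rw [hu.eq_one s hs h1.le, ← hu.eq_one 1 zero_le_one le_rfl]
    exact h3.trans (mul_le_mul_of_nonneg_left (by linarith) hK0)

/-! ### Counting long cycles -/

/-- In a non-increasing list the entries above `m` form an initial segment. The default `0` is never
above `m`, so positions past the end are handled correctly. -/
theorem getD_le_iff_of_pairwise {l : List ℕ} (hl : l.Pairwise fun a b => b ≤ a) (i m : ℕ) :
    l.getD i 0 ≤ m ↔ (l.filter (m < ·)).length ≤ i := by
  induction l generalizing i with
  | nil => simp
  | cons a l ih =>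
    rw [List.pairwise_cons] at hl
    by_cases ha : m < a
    · cases i with
      | zero => simp [ha]
      | succ i => simpa [ha] using ih hl.2 i
    · have h0 : l.filter (m < ·) = [] := by
        rw [List.filter_eq_nil_iff]
        intro b hb
        have := hl.1 b hb
        simp; omega
      have h1 := ih hl.2
      rw [h0] at h1
      cases i with
      | zero => simp [ha, h0]; omega
      | succ i => simpa [ha, h0] using h1 i

/-- The number of cycles of `φ` that are longer than `m`. -/
noncomputable def longCycleCount {α : Type*} [Fintype α] (m : ℕ) (φ : α → α) : ℕ :=
  ((cycles φ).filter fun c => m < c.length).card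

theorem rthLongestCycle_le_iff {α : Type*} [Fintype α] {r : ℕ} (hr : 1 ≤ r) (m : ℕ) (φ : α → α) :
    rthLongestCycle r φ ≤ m ↔ longCycleCount m φ < r := by
  rw [rthLongestCycle, cycleLengths, getD_le_iff_of_pairwise (Multiset.pairwise_sort _ _),
    ← Multiset.coe_card, ← Multiset.filter_coe, Multiset.sort_eq, Multiset.filter_map,
    Multiset.card_map, longCycleCount, Finset.card_def, Finset.filter_val]
  simp only [Function.comp_def]
  omega

open scoped Classical in
theorem card_iterates_eq_minimalPeriod {α : Type*} [Fintype α] {φ : α → α} {x : α}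
    (hx : x ∈ Function.periodicPts φ) :
    (Finset.univ.filter fun y => ∃ n, φ^[n] x = y).card = Function.minimalPeriod φ x := by
  have h : (Finset.univ.filter fun y => ∃ n, φ^[n] x = y) =
      (Finset.range (Function.minimalPeriod φ x)).image fun n => φ^[n] x := by
    ext y
    simp only [Finset.mem_filter, Finset.mem_univ, true_and, Finset.mem_image, Finset.mem_range]
    constructor
    · rintro ⟨n, rfl⟩
      exact ⟨n % Function.minimalPeriod φ x,
        Nat.mod_lt _ (Function.minimalPeriod_pos_of_mem_periodicPts hx),
        Function.iterate_mod_minimalPeriod_eq⟩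
    · rintro ⟨n, -, rfl⟩
      exact ⟨n, rfl⟩
  rw [h, Finset.card_image_of_injOn, Finset.card_range]
  rw [Finset.coe_range]
  exact Function.iterate_injOn_Iio_minimalPeriod

/-- The number of cycles longer than `m`, written as a sum over points. -/
noncomputable def cycleWeight {α : Type*} [Fintype α] (m : ℕ) (φ : α → α) : ℝ :=
  ∑ x, if m < Function.minimalPeriod φ x then (Function.minimalPeriod φ x : ℝ)⁻¹ else 0

theorem mem_cyclicPoints {α : Type*} [Fintype α] {φ : α → α} {x : α} :
    x ∈ cyclicPoints φ ↔ x ∈ Function.periodicPts φ := by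
  classical
  simp [cyclicPoints]

open scoped Classical in
theorem card_periodicOrbit_fiber {α : Type*} [Fintype α] {φ : α → α} {c : Cycle α}
    (hc : c ∈ cycles φ) :
    ((cyclicPoints φ).filter fun y => Function.periodicOrbit φ y = c).card = c.length ∧
      0 < c.length := by
  simp only [cycles, Finset.mem_image, mem_cyclicPoints] at hc
  obtain ⟨x, hx, rfl⟩ := hc
  rw [Function.periodicOrbit_length, ← card_iterates_eq_minimalPeriod hx]
  refine ⟨?_, ?_⟩
  · congr 1
    ext y
    simp only [Finset.mem_filter, mem_cyclicPoints, Finset.mem_univ, true_and]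
    constructor
    · rintro ⟨hy, h⟩
      rw [← Function.mem_periodicOrbit_iff hx, ← h]
      exact Function.self_mem_periodicOrbit hy
    · rintro ⟨n, rfl⟩
      refine ⟨?_, Function.periodicOrbit_apply_iterate_eq hx n⟩
      rw [← Function.minimalPeriod_pos_iff_mem_periodicPts,
        Function.minimalPeriod_apply_iterate hx]
      exact Function.minimalPeriod_pos_of_mem_periodicPts hx
  · rw [card_iterates_eq_minimalPeriod hx]
    exact Function.minimalPeriod_pos_of_mem_periodicPts hx

/-- A cycle of length `ℓ > m` consists of `ℓ` points of weight `1/ℓ`; points off the cycles have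
minimal period `0` and weight `0`. The sum over points is easier to transport along bijections and
to split over invariant pieces than the set of cycles. -/
theorem cycleWeight_eq {α : Type*} [Fintype α] (m : ℕ) (φ : α → α) :
    cycleWeight m φ = longCycleCount m φ := by
  classical
  have h1 : cycleWeight m φ = ∑ x ∈ cyclicPoints φ,
      if m < Function.minimalPeriod φ x then (Function.minimalPeriod φ x : ℝ)⁻¹ else 0 := by
    refine (Finset.sum_subset (Finset.subset_univ _) fun x _ hx => ?_).symm
    rw [mem_cyclicPoints] at hx
    rw [Function.minimalPeriod_eq_zero_of_notMem_periodicPts hx]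
    simp
  have h2 : ∀ x ∈ cyclicPoints φ, Function.periodicOrbit φ x ∈ cycles φ := fun x hx => by
    unfold cycles
    exact Finset.mem_image_of_mem _ hx
  rw [h1, ← Finset.sum_fiberwise_of_maps_to h2, longCycleCount, Finset.card_filter]
  push_cast
  refine Finset.sum_congr rfl fun c hc => ?_
  obtain ⟨h3, h4⟩ := card_periodicOrbit_fiber hc
  rw [Finset.sum_congr rfl (g := fun _ => if m < c.length then (c.length : ℝ)⁻¹ else 0)]
  · rw [Finset.sum_const, h3, nsmul_eq_mul]
    have : (c.length : ℝ) ≠ 0 := by positivity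
    split_ifs <;> simp [this]
  · intro x hx
    rw [Finset.mem_filter] at hx
    rw [← Function.periodicOrbit_length, hx.2]

theorem minimalPeriod_of_semiconj {α β : Type*} {f : α → α} {g : β → β} {i : β → α}
    (hi : Function.Injective i) (h : Function.Semiconj i g f) (y : β) :
    Function.minimalPeriod f (i y) = Function.minimalPeriod g y := by
  rw [Function.minimalPeriod_eq_minimalPeriod_iff]
  intro n
  rw [Function.IsPeriodicPt, Function.IsFixedPt, ← (h.iterate_right n).eq, hi.eq_iff]
  rfl

theorem cycleWeight_of_semiconj {α β : Type*} [Fintype α] [Fintype β] (e : β ≃ α) {f : α → α}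
    {g : β → β} (h : Function.Semiconj e g f) (m : ℕ) : cycleWeight m f = cycleWeight m g := by
  unfold cycleWeight
  rw [← e.sum_comp]
  refine Finset.sum_congr rfl fun y _ => ?_
  rw [minimalPeriod_of_semiconj e.injective h]

open scoped Classical in
/-- If `f` preserves a set and its complement, then the weight is the sum of the two weights. -/
theorem cycleWeight_split {α : Type*} [Fintype α] (m : ℕ) (p : α → Prop)
    [Fintype {x // p x}] [Fintype {x // ¬p x}] {f : α → α} {g : {x // p x} → {x // p x}} {g' : {x // ¬p x} → {x // ¬p x}}
    (h : ∀ x, f x.1 = (g x).1) (h' : ∀ x, f x.1 = (g' x).1) :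
    cycleWeight m f = cycleWeight m g + cycleWeight m g' := by
  unfold cycleWeight
  rw [← Fintype.sum_subtype_add_sum_subtype p]
  congr 1
  · refine Finset.sum_congr (by ext; simp) fun y _ => ?_
    rw [minimalPeriod_of_semiconj Subtype.val_injective (fun x => (h x).symm)]
  · refine Finset.sum_congr (by ext; simp) fun y _ => ?_
    rw [minimalPeriod_of_semiconj Subtype.val_injective (fun x => (h' x).symm)]

/-! ### Permutations: splitting off the cycle of a point -/

open scoped Classical in
/-- The number of permutations of `α` whose number of cycles longer than `m` satisfies `P`. -/
noncomputable def permCountOn (α : Type*) [Fintype α] (m : ℕ) (P : ℝ → Prop) : ℕ :=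
  (Finset.univ.filter fun σ : Equiv.Perm α => P (cycleWeight m σ)).card

/-- `permCountOn` for the standard set with `n` elements. -/
noncomputable def permCount (n m : ℕ) (P : ℝ → Prop) : ℕ := permCountOn (Fin n) m P

theorem permCountOn_congr {α β : Type*} [Fintype α] [Fintype β] (e : α ≃ β) (m : ℕ)
    (P : ℝ → Prop) : permCountOn α m P = permCountOn β m P := by
  classical
  refine Finset.card_equiv e.permCongr fun σ => ?_
  simp only [Finset.mem_filter, Finset.mem_univ, true_and]
  rw [cycleWeight_of_semiconj e (f := e.permCongr σ) (g := σ) (fun x => by simp) m]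

theorem permCountOn_eq {α : Type*} [Fintype α] {n : ℕ} (h : Fintype.card α = n) (m : ℕ)
    (P : ℝ → Prop) : permCountOn α m P = permCount n m P :=
  permCountOn_congr (Fintype.equivFinOfCardEq h) m P

open scoped Classical in
/-- The number of permutations of `α` that act transitively. -/
noncomputable def transCountOn (α : Type*) [Fintype α] : ℕ :=
  (Finset.univ.filter fun σ : Equiv.Perm α => ∀ x y, ∃ n, σ^[n] x = y).card

theorem transCountOn_congr {α β : Type*} [Fintype α] [Fintype β] (e : α ≃ β) :
    transCountOn α = transCountOn β := by
  classical
  refine Finset.card_equiv e.permCongr fun σ => ?_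
  simp only [Finset.mem_filter, Finset.mem_univ, true_and]
  have h : Function.Semiconj e σ (e.permCongr σ) := fun x => by simp
  have h2 : ∀ n x, (e.permCongr σ)^[n] (e x) = e (σ^[n] x) := fun n x =>
    ((h.iterate_right n).eq x).symm
  constructor
  · intro H x y
    obtain ⟨n, hn⟩ := H (e.symm x) (e.symm y)
    refine ⟨n, ?_⟩
    have := h2 n (e.symm x)
    rw [hn] at this
    simpa using this
  · intro H x y
    obtain ⟨n, hn⟩ := H (e x) (e y)
    exact ⟨n, e.injective (by rw [← h2, hn])⟩

theorem mem_periodicPts_perm {α : Type*} [Finite α] (σ : Equiv.Perm α) (x : α) :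
    x ∈ Function.periodicPts σ :=
  Function.Injective.mem_periodicPts σ.injective x

theorem exists_iterate_symm {α : Type*} [Finite α] (σ : Equiv.Perm α) {x y : α} {i : ℕ}
    (h : σ^[i] x = y) : ∃ n, σ^[n] y = x := by
  have hp := Function.minimalPeriod_pos_of_mem_periodicPts (mem_periodicPts_perm σ x)
  -- Since the period is positive, `i` full turns take at least `i` steps, so the subtraction is not
  -- truncated.
  refine ⟨i * Function.minimalPeriod σ x - i, ?_⟩
  rw [← h, ← Function.iterate_add_apply, Nat.sub_add_cancel (Nat.le_mul_of_pos_right i hp)]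
  exact ((Function.isPeriodicPt_minimalPeriod σ x).const_mul i).eq

theorem transitive_of_point {α : Type*} [Finite α] (σ : Equiv.Perm α) (a : α)
    (h : ∀ y, ∃ n, σ^[n] a = y) (x y : α) : ∃ n, σ^[n] x = y := by
  obtain ⟨i, hi⟩ := h x
  obtain ⟨j, hj⟩ := exists_iterate_symm σ hi
  obtain ⟨k, hk⟩ := h y
  exact ⟨k + j, by rw [Function.iterate_add_apply, hj, hk]⟩

theorem cycleWeight_of_transitive {α : Type*} [Fintype α] [Nonempty α] (m : ℕ)
    (σ : Equiv.Perm α) (h : ∀ x y, ∃ n, σ^[n] x = y) :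
    cycleWeight m σ = if m < Fintype.card α then 1 else 0 := by
  classical
  have h1 : ∀ x, Function.minimalPeriod σ x = Fintype.card α := fun x => by
    rw [← card_iterates_eq_minimalPeriod (mem_periodicPts_perm σ x), Finset.filter_true_of_mem,
      Finset.card_univ]
    exact fun y _ => h x y
  unfold cycleWeight
  simp only [h1, Finset.sum_const, Finset.card_univ, nsmul_eq_mul]
  have : (Fintype.card α : ℝ) ≠ 0 := by simp
  split_ifs <;> simp [this]

open scoped Classical in
/-- The set of points on the cycle of `a`. -/
noncomputable def orbitFinset {α : Type*} [Fintype α] (σ : Equiv.Perm α) (a : α) : Finset α :=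
  Finset.univ.filter fun y => ∃ n, σ^[n] a = y

theorem mem_orbitFinset {α : Type*} [Fintype α] {σ : Equiv.Perm α} {a y : α} :
    y ∈ orbitFinset σ a ↔ ∃ n, σ^[n] a = y := by
  classical
  simp [orbitFinset]

theorem apply_mem_orbitFinset {α : Type*} [Fintype α] {σ : Equiv.Perm α} {a y : α} :
    σ y ∈ orbitFinset σ a ↔ y ∈ orbitFinset σ a := by
  simp only [mem_orbitFinset]
  constructor
  · rintro ⟨n, hn⟩
    obtain ⟨i, hi⟩ := exists_iterate_symm σ hn
    obtain ⟨j, hj⟩ := exists_iterate_symm σ (x := y) (y := a) (i := i + 1)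
      (by rw [Function.iterate_succ_apply, hi])
    exact ⟨j, hj⟩
  · rintro ⟨n, rfl⟩
    exact ⟨n + 1, Function.iterate_succ_apply' _ _ _⟩

open scoped Classical in
-- Such a permutation is a transitive permutation of `C` glued to an arbitrary permutation of the
-- complement; the first part contributes a single cycle of length `C.card`.
theorem card_perm_orbitFinset_eq {α : Type*} [Fintype α] (m : ℕ) (P : ℝ → Prop) {a : α}
    {C : Finset α} (ha : a ∈ C) :
    (Finset.univ.filter fun σ : Equiv.Perm α =>
      orbitFinset σ a = C ∧ P (cycleWeight m σ)).card =
    transCountOn {x // x ∈ C} *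
      permCountOn {x // x ∉ C} m fun w => P ((if m < C.card then 1 else 0) + w) := by
  have : Nonempty {x // x ∈ C} := ⟨⟨a, ha⟩⟩
  rw [transCountOn, permCountOn, ← Finset.card_product]
  symm
  have hit : ∀ (c : Equiv.Perm {x // x ∈ C}) (τ : Equiv.Perm {x // x ∉ C}) (n : ℕ) (x),
      (Equiv.Perm.subtypeCongr c τ)^[n] (x : {x // x ∈ C}).1 = (c^[n] x).1 := by
    intro c τ n x
    have h : Function.Semiconj Subtype.val c (Equiv.Perm.subtypeCongr c τ) :=
      fun x => (Equiv.Perm.subtypeCongr.left_apply_subtype c τ x).symm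
    exact ((h.iterate_right n).eq x).symm
  have hw : ∀ (c : Equiv.Perm {x // x ∈ C}) (τ : Equiv.Perm {x // x ∉ C}),
      (∀ x y, ∃ n, c^[n] x = y) → cycleWeight m (Equiv.Perm.subtypeCongr c τ) =
        (if m < C.card then 1 else 0) + cycleWeight m τ := by
    intro c τ hc
    rw [cycleWeight_split m (· ∈ C)
      (fun x => Equiv.Perm.subtypeCongr.left_apply_subtype c τ x)
      (fun x => Equiv.Perm.subtypeCongr.right_apply_subtype c τ x), ← Fintype.card_coe,
      ← cycleWeight_of_transitive m c hc]
  refine Finset.card_bij (fun q _ => Equiv.Perm.subtypeCongr q.1 q.2) ?_ ?_ ?_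
  · rintro ⟨c, τ⟩ h
    simp only [Finset.mem_product, Finset.mem_filter, Finset.mem_univ, true_and] at h ⊢
    refine ⟨?_, by rw [hw c τ h.1]; exact h.2⟩
    ext y
    rw [mem_orbitFinset]
    constructor
    · rintro ⟨n, rfl⟩
      rw [hit c τ n ⟨a, ha⟩]
      exact (c^[n] ⟨a, ha⟩).2
    · intro hy
      obtain ⟨n, hn⟩ := h.1 ⟨a, ha⟩ ⟨y, hy⟩
      exact ⟨n, by rw [hit c τ n ⟨a, ha⟩, hn]⟩
  · rintro ⟨c, τ⟩ - ⟨c', τ'⟩ - h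
    simp only at h
    rw [Prod.mk.injEq]
    constructor
    · ext x
      have := congrArg (fun σ : Equiv.Perm α => σ x.1) h
      simpa using this
    · ext x
      have := congrArg (fun σ : Equiv.Perm α => σ x.1) h
      simpa using this
  · intro σ hσ
    simp only [Finset.mem_filter, Finset.mem_univ, true_and] at hσ
    obtain ⟨h1, h2⟩ := hσ
    have hC : ∀ y, σ y ∈ C ↔ y ∈ C := fun y => by rw [← h1]; exact apply_mem_orbitFinset
    have hC' : ∀ y, σ y ∉ C ↔ y ∉ C := fun y => not_congr (hC y)
    have h3 : Equiv.Perm.subtypeCongr (σ.subtypePerm hC) (σ.subtypePerm hC') = σ := by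
      ext x
      rw [Equiv.Perm.subtypeCongr.apply]
      split_ifs <;> rfl
    have h4 : ∀ x y, ∃ n, (σ.subtypePerm hC)^[n] x = y := by
      refine transitive_of_point _ ⟨a, ha⟩ fun y => ?_
      obtain ⟨n, hn⟩ := mem_orbitFinset.1 (show y.1 ∈ orbitFinset σ a by rw [h1]; exact y.2)
      refine ⟨n, Subtype.ext ?_⟩
      rw [← hit _ (σ.subtypePerm hC'), h3, hn]
    refine ⟨(σ.subtypePerm hC, σ.subtypePerm hC'), ?_, h3⟩
    simp only [Finset.mem_product, Finset.mem_filter, Finset.mem_univ, true_and]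
    refine ⟨h4, ?_⟩
    rw [← hw _ _ h4, h3]
    exact h2

open scoped Classical in
-- Permutations are sorted by the cycle of a fixed point `a`. Here `j` counts the other points on
-- that cycle, chosen among the `n` points different from `a`.
theorem permCountOn_card_succ {α : Type*} [Fintype α] {n : ℕ} (hα : Fintype.card α = n + 1) (m : ℕ)
    (P : ℝ → Prop) :
    permCountOn α m P = ∑ j ∈ Finset.range (n + 1), n.choose j *
      (transCountOn (Fin (j + 1)) *
        permCount (n - j) m fun w => P ((if m < j + 1 then 1 else 0) + w)) := by
  have : Nonempty α := Fintype.card_pos_iff.1 (by omega)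
  obtain ⟨a⟩ := this
  have hmaps : ∀ σ ∈ (Finset.univ.filter fun σ : Equiv.Perm α => P (cycleWeight m σ)),
      (orbitFinset σ a).erase a ∈ (Finset.univ.erase a).powerset := fun σ _ => by
    rw [Finset.mem_powerset]
    exact Finset.erase_subset_erase _ (Finset.subset_univ _)
  rw [permCountOn, Finset.card_eq_sum_card_fiberwise hmaps]
  have hfib : ∀ D ∈ (Finset.univ.erase a).powerset,
      ((Finset.univ.filter fun σ : Equiv.Perm α => P (cycleWeight m σ)).filter
        fun σ => (orbitFinset σ a).erase a = D).card =
      transCountOn (Fin (D.card + 1)) *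
        permCount (n - D.card) m fun w => P ((if m < D.card + 1 then 1 else 0) + w) := by
    intro D hD
    have h0 : a ∉ D := fun h => by
      simpa using Finset.mem_powerset.1 hD h
    have h1 := card_perm_orbitFinset_eq m P (Finset.mem_insert_self a D)
    have hcard : (insert a D).card = D.card + 1 := Finset.card_insert_of_notMem h0
    rw [permCountOn_eq (n := n - D.card), transCountOn_congr
      (Fintype.equivFinOfCardEq (n := D.card + 1) (by rw [Fintype.card_coe, hcard])), hcard] at h1
    · rw [← h1, Finset.filter_filter]
      congr 1
      ext σ
      simp only [Finset.mem_filter, Finset.mem_univ, true_and]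
      have h2 : a ∈ orbitFinset σ a := mem_orbitFinset.2 ⟨0, rfl⟩
      rw [and_comm]
      refine and_congr_left fun _ => ?_
      constructor
      · intro h
        rw [← h, Finset.insert_erase h2]
      · intro h
        rw [h, Finset.erase_insert h0]
    · have := Fintype.card_subtype_compl (fun x => x ∈ insert a D)
      rw [this, Fintype.card_coe, hcard, hα]
      omega
  rw [Finset.sum_congr rfl hfib, Finset.sum_powerset_apply_card (fun j =>
    transCountOn (Fin (j + 1)) *
        permCount (n - j) m fun w => P ((if m < j + 1 then 1 else 0) + w))]
  rw [Finset.card_erase_of_mem (Finset.mem_univ a), Finset.card_univ, hα]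
  simp

theorem permCount_succ (n m : ℕ) (P : ℝ → Prop) :
    permCount (n + 1) m P = ∑ j ∈ Finset.range (n + 1), n.choose j *
      (transCountOn (Fin (j + 1)) *
        permCount (n - j) m fun w => P ((if m < j + 1 then 1 else 0) + w)) :=
  permCountOn_card_succ (Fintype.card_fin _) m P

theorem permCountOn_mono (α : Type*) [Fintype α] (m : ℕ) {P Q : ℝ → Prop}
    (h : ∀ σ : Equiv.Perm α, P (cycleWeight m σ) → Q (cycleWeight m σ)) :
    permCountOn α m P ≤ permCountOn α m Q := by
  classical
  exact Finset.card_le_card (Finset.monotone_filter_right _ fun σ _ => h σ)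

theorem permCount_true (n m : ℕ) : permCount n m (fun _ => True) = n.factorial := by
  rw [permCount, permCountOn]
  simp [Fintype.card_perm]

/-- The unrestricted recurrence determines these numbers: it expresses `(n + 1)!` as `n + 1` terms,
of which the first `n` equal `n!` by induction, so the last one does too. -/
theorem transCountOn_fin (j : ℕ) : transCountOn (Fin (j + 1)) = j.factorial := by
  induction j using Nat.strong_induction_on with
  | _ n ih =>
    have h := permCount_succ n 0 (fun _ => True)
    simp only [permCount_true] at h
    rw [Finset.sum_range_succ, Nat.choose_self, Nat.sub_self, Nat.factorial_zero, one_mul, mul_one,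
      Finset.sum_congr rfl (g := fun _ => n.factorial)] at h
    · rw [Finset.sum_const, Finset.card_range, Nat.factorial_succ, smul_eq_mul] at h
      linarith
    · intro j hj
      rw [Finset.mem_range] at hj
      rw [ih j hj, ← mul_assoc, Nat.choose_mul_factorial_mul_factorial hj.le]

/-- The probability that a uniform permutation of `k` points has fewer than `r` cycles longer than
`m`. -/
noncomputable def permProb (r m k : ℕ) : ℝ := permCount k m (fun w => w < r) / k.factorial

theorem cycleWeight_nonneg {α : Type*} [Fintype α] (m : ℕ) (φ : α → α) : 0 ≤ cycleWeight m φ := by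
  rw [cycleWeight_eq]; positivity

theorem permProb_zero (m k : ℕ) : permProb 0 m k = 0 := by
  have h : permCount k m (fun w => w < (0 : ℕ)) = 0 := by
    rw [permCount, permCountOn, Finset.card_eq_zero, Finset.filter_eq_empty_iff]
    intro σ _
    have := cycleWeight_nonneg m σ
    simpa using this
  rw [permProb, h]; simp

theorem permProb_nonneg (r m k : ℕ) : 0 ≤ permProb r m k := by unfold permProb; positivity

theorem permProb_le_one (r m k : ℕ) : permProb r m k ≤ 1 := by
  unfold permProb
  rw [div_le_one (by positivity)]
  norm_cast
  rw [← permCount_true k m]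
  exact permCountOn_mono _ m fun σ _ => trivial

theorem permProb_mono {r s : ℕ} (h : r ≤ s) (m k : ℕ) : permProb r m k ≤ permProb s m k := by
  unfold permProb
  gcongr
  exact permCountOn_mono _ m fun σ h' => lt_of_lt_of_le h' (by exact_mod_cast h)

theorem permProb_of_le {r m k : ℕ} (hr : 1 ≤ r) (hk : k ≤ m) : permProb r m k = 1 := by
  refine le_antisymm (permProb_le_one r m k) ?_
  unfold permProb
  rw [one_le_div (by positivity)]
  norm_cast
  rw [← permCount_true k m]
  refine permCountOn_mono _ m fun σ _ => ?_
  have h0 : cycleWeight m σ = 0 := by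
    refine Finset.sum_eq_zero fun x _ => if_neg ?_
    have := Function.minimalPeriod_le_card (f := σ) (x := x)
    rw [Fintype.card_fin] at this
    omega
  rw [h0]
  exact_mod_cast hr

/-- The cycle through a given point has uniform length. If it is longer than `m`, the remaining
points may carry one long cycle less, which replaces `r + 1` by `r`. -/
theorem permProb_succ (r m n : ℕ) :
    (n + 1) * permProb (r + 1) m (n + 1) =
      ∑ i ∈ Finset.range (n + 1), permProb (r + 1) m i -
        ∑ i ∈ Finset.range (n + 1 - m), (permProb (r + 1) m i - permProb r m i) := by
  have h1 : ((n : ℝ) + 1) * permProb (r + 1) m (n + 1) =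
      permCount (n + 1) m (fun w => w < (r + 1 : ℕ)) / n.factorial := by
    rw [permProb, Nat.factorial_succ]
    push_cast
    have : (n.factorial : ℝ) ≠ 0 := by positivity
    field_simp
  have h2 : ∀ j ∈ Finset.range (n + 1), ((n.choose j * (transCountOn (Fin (j + 1)) *
        permCount (n - j) m fun w => (if m < j + 1 then 1 else 0) + w < (r + 1 : ℕ)) : ℕ) : ℝ) /
        n.factorial = if j < m then permProb (r + 1) m (n - j) else permProb r m (n - j) := by
    intro j hj
    have hj' : j ≤ n := by simpa [Nat.lt_succ_iff] using hj
    rw [transCountOn_fin]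
    have h3 : ((n.choose j : ℝ) * j.factorial) * (n - j).factorial = n.factorial := by
      exact_mod_cast Nat.choose_mul_factorial_mul_factorial hj'
    push_cast
    rw [← mul_assoc, ← h3, mul_div_mul_left]
    · split_ifs with h4 h5 h5
      · omega
      · unfold permProb
        congr 3
        ext w
        constructor <;> intro h <;> linarith
      · unfold permProb
        congr 3
        ext w
        push_cast
        constructor <;> intro h <;> linarith
      · omega
    · have := Nat.choose_pos hj'
      positivity
  rw [h1, permCount_succ]
  push_cast [Finset.sum_div] at h2 ⊢
  rw [Finset.sum_congr rfl h2, ← Finset.sum_range_reflect]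
  -- After reflection `i` counts the points off the cycle. The cycle has length `n + 1 - i`, which
  -- exceeds `m` exactly when `i < n + 1 - m`.
  have h5 : ∀ i ∈ Finset.range (n + 1),
      (if n + 1 - 1 - i < m then permProb (r + 1) m (n - (n + 1 - 1 - i))
        else permProb r m (n - (n + 1 - 1 - i))) =
      permProb (r + 1) m i - if i < n + 1 - m then permProb (r + 1) m i - permProb r m i else 0 := by
    intro i hi
    rw [Finset.mem_range] at hi
    have : n - (n + 1 - 1 - i) = i := by omega
    rw [this]
    split_ifs <;> first | omega | ring
  rw [Finset.sum_congr rfl h5, Finset.sum_sub_distrib, ← Finset.sum_filter]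
  congr 2
  ext i
  simp
  omega

/-- Subtracting consecutive instances of `permProb_succ` removes both sums up to one term each. With
`ξ = k/m` this is the delay equation discretised with step `1/m`, the delay `1` becoming `m` steps.
-/
theorem permProb_sub (r : ℕ) {m : ℕ} (hm : 1 ≤ m) (q : ℕ) :
    ((m + q : ℕ) + 1 : ℝ) * (permProb (r + 1) m (m + q + 1) - permProb (r + 1) m (m + q)) =
      -(permProb (r + 1) m q - permProb r m q) := by
  obtain ⟨m, rfl⟩ := Nat.exists_eq_add_of_le' hm
  have h1 := permProb_succ r (m + 1) (m + 1 + q)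
  have h2 := permProb_succ r (m + 1) (m + q)
  rw [Finset.sum_range_succ, show m + 1 + q + 1 - (m + 1) = q + 1 by omega,
    Finset.sum_range_succ _ q] at h1
  rw [show m + q + 1 - (m + 1) = q by omega, show m + q + 1 = m + 1 + q by omega] at h2
  push_cast at h1 h2 ⊢
  linear_combination h1 - h2

/-! ### Forests and the number of cyclic points -/

/-- Up to the first visit to `S`, an orbit only uses values of the map outside `S`. -/
theorem exists_iterate_mem_congr {α : Type*} {φ ψ : α → α} {S : Set α}
    (h : ∀ x ∉ S, φ x = ψ x) {x : α} (hx : ∃ i, φ^[i] x ∈ S) : ∃ i, ψ^[i] x ∈ S := by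
  obtain ⟨i, hi⟩ := hx
  induction i generalizing x with
  | zero => exact ⟨0, hi⟩
  | succ i ih =>
    by_cases hxS : x ∈ S
    · exact ⟨0, hxS⟩
    · rw [Function.iterate_succ_apply] at hi
      obtain ⟨j, hj⟩ := ih hi
      refine ⟨j + 1, ?_⟩
      rwa [Function.iterate_succ_apply, ← h x hxS]

theorem iterate_mem_of_mapsTo {α : Type*} {φ : α → α} {S : Set α} (hS : ∀ x ∈ S, φ x ∈ S) {x : α}
    (hx : x ∈ S) (i : ℕ) : φ^[i] x ∈ S := by
  induction i with
  | zero => exact hx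
  | succ i ih => rw [Function.iterate_succ_apply']; exact hS _ ih

/-- A periodic point that reaches an invariant set lies in it. -/
theorem mem_of_mem_periodicPts_of_iterate_mem {α : Type*} {φ : α → α} {S : Set α}
    (hS : ∀ x ∈ S, φ x ∈ S) {x : α} (hx : x ∈ Function.periodicPts φ) {i : ℕ} (hi : φ^[i] x ∈ S) :
    x ∈ S := by
  obtain ⟨p, hp, hx⟩ := hx
  have h1 : φ^[i * p] x = x := (hx.const_mul i).eq
  rw [← h1, ← Nat.sub_add_cancel (Nat.le_mul_of_pos_right i hp), Function.iterate_add_apply]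
  exact iterate_mem_of_mapsTo hS hi _

/-- `φ` is the parent map of a forest with set of roots `S`. -/
def IsForest {α : Type*} (S : Finset α) (φ : α → α) : Prop :=
  (∀ x ∈ S, φ x = x) ∧ ∀ x, ∃ i, φ^[i] x ∈ S

open scoped Classical in
/-- The number of forests on `α` with set of roots `S`. -/
noncomputable def forestCount {α : Type*} [Fintype α] (S : Finset α) : ℕ :=
  (Finset.univ.filter fun φ : α → α => IsForest S φ).card

open scoped Classical in
/-- The number of pairs of a forest with roots `S` and a vertex in the tree of `s`. -/
noncomputable def treeCount {α : Type*} [Fintype α] (S : Finset α) (s : α) : ℕ :=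
  (Finset.univ.filter fun q : (α → α) × α => IsForest S q.1 ∧ ∃ i, q.1^[i] q.2 = s).card

theorem IsForest.iterate_root {α : Type*} {S : Finset α} {φ : α → α} (h : IsForest S φ) {s : α}
    (hs : s ∈ S) (i : ℕ) : φ^[i] s = s :=
  Function.IsFixedPt.iterate (h.1 s hs) i

theorem IsForest.root_unique {α : Type*} {S : Finset α} {φ : α → α} (h : IsForest S φ) {s t : α}
    (hs : s ∈ S) (ht : t ∈ S) {x : α} {i j : ℕ} (hi : φ^[i] x = s) (hj : φ^[j] x = t) : s = t := by
  rw [← h.iterate_root hs j, ← hi, ← Function.iterate_add_apply, add_comm,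
    Function.iterate_add_apply, hj, h.iterate_root ht]

open scoped Classical in
-- Every vertex lies in the tree of exactly one root.
theorem sum_treeCount {α : Type*} [Fintype α] (S : Finset α) :
    ∑ s ∈ S, treeCount S s = Fintype.card α * forestCount S := by
  have hd : ∀ s ∈ S, ∀ t ∈ S, s ≠ t → Disjoint
      (Finset.univ.filter fun q : (α → α) × α => IsForest S q.1 ∧ ∃ i, q.1^[i] q.2 = s)
      (Finset.univ.filter fun q : (α → α) × α => IsForest S q.1 ∧ ∃ i, q.1^[i] q.2 = t) := by
    intro s hs t ht hst
    rw [Finset.disjoint_filter]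
    rintro ⟨φ, x⟩ - ⟨h, i, hi⟩ ⟨-, j, hj⟩
    exact hst (h.root_unique hs ht hi hj)
  unfold treeCount forestCount
  rw [← Finset.card_biUnion hd, mul_comm, ← Finset.card_univ, ← Finset.card_product]
  congr 1
  ext ⟨φ, x⟩
  simp only [Finset.mem_biUnion, Finset.mem_filter, Finset.mem_univ, true_and, Finset.mem_product,
    and_true]
  constructor
  · rintro ⟨s, hs, h, -⟩
    exact h
  · intro h
    obtain ⟨i, hi⟩ := h.2 x
    exact ⟨_, hi, h, i, rfl⟩

open scoped Classical in
-- Conjugation by the transposition of two roots preserves `S` and exchanges their trees.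
theorem treeCount_eq {α : Type*} [Fintype α] {S : Finset α} {s t : α} (hs : s ∈ S) (ht : t ∈ S) :
    treeCount S s = treeCount S t := by
  have hS : ∀ x, Equiv.swap s t x ∈ S ↔ x ∈ S := by
    intro x
    rcases eq_or_ne x s with rfl | h1
    · simp [hs, ht]
    rcases eq_or_ne x t with rfl | h2
    · simp [hs, ht]
    · rw [Equiv.swap_apply_of_ne_of_ne h1 h2]
  have key : ∀ φ : α → α, IsForest S φ →
      IsForest S (Equiv.swap s t ∘ φ ∘ Equiv.swap s t) := by
    intro φ h
    have hc : Function.Semiconj (Equiv.swap s t) φ (Equiv.swap s t ∘ φ ∘ Equiv.swap s t) :=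
      fun x => by simp
    refine ⟨fun x hx => ?_, fun x => ?_⟩
    · simp [h.1 _ ((hS x).2 hx)]
    · obtain ⟨i, hi⟩ := h.2 (Equiv.swap s t x)
      refine ⟨i, ?_⟩
      have := (hc.iterate_right i).eq (Equiv.swap s t x)
      rw [Equiv.swap_apply_self] at this
      rw [← this, hS]
      exact hi
  have key2 : ∀ (φ : α → α) (x : α) (i : ℕ),
      (Equiv.swap s t ∘ φ ∘ Equiv.swap s t)^[i] (Equiv.swap s t x) =
        Equiv.swap s t (φ^[i] x) := by
    intro φ x i
    have hc : Function.Semiconj (Equiv.swap s t) φ (Equiv.swap s t ∘ φ ∘ Equiv.swap s t) :=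
      fun x => by simp
    exact ((hc.iterate_right i).eq x).symm
  have hinv : ∀ φ : α → α, Equiv.swap s t ∘ (Equiv.swap s t ∘ φ ∘ Equiv.swap s t) ∘
      Equiv.swap s t = φ := fun φ => by ext x; simp
  refine Finset.card_bij'
    (fun q _ => (Equiv.swap s t ∘ q.1 ∘ Equiv.swap s t, Equiv.swap s t q.2))
    (fun q _ => (Equiv.swap s t ∘ q.1 ∘ Equiv.swap s t, Equiv.swap s t q.2)) ?_ ?_ ?_ ?_
  · rintro ⟨φ, x⟩ h
    simp only [Finset.mem_filter, Finset.mem_univ, true_and] at h ⊢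
    obtain ⟨h, i, hi⟩ := h
    exact ⟨key φ h, i, by rw [key2, hi, Equiv.swap_apply_left]⟩
  · rintro ⟨φ, x⟩ h
    simp only [Finset.mem_filter, Finset.mem_univ, true_and] at h ⊢
    obtain ⟨h, i, hi⟩ := h
    exact ⟨key φ h, i, by rw [key2, hi, Equiv.swap_apply_right]⟩
  · rintro ⟨φ, x⟩ -
    simp only [hinv, Equiv.swap_apply_self]
  · rintro ⟨φ, x⟩ -
    simp only [hinv, Equiv.swap_apply_self]

open scoped Classical in
/-- Cutting the edge above `t` turns a forest with roots `S` into one with roots `insert t S`,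
together with a vertex outside the tree of `t`. -/
theorem forestCount_add_treeCount {α : Type*} [Fintype α] {S : Finset α} {t : α} (ht : t ∉ S) :
    forestCount S + treeCount (insert t S) t = Fintype.card α * forestCount (insert t S) := by
  have h1 : forestCount S = (Finset.univ.filter fun q : (α → α) × α =>
      IsForest (insert t S) q.1 ∧ ¬∃ i, q.1^[i] q.2 = t).card := by
    refine Finset.card_bij' (fun φ _ => (Function.update φ t t, φ t))
      (fun q _ => Function.update q.1 t q.2) ?_ ?_ ?_ ?_
    · intro φ h
      simp only [Finset.mem_filter, Finset.mem_univ, true_and] at h ⊢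
      have hoff : ∀ x ∉ ({t} : Set α), Function.update φ t t x = φ x := fun x hx =>
        Function.update_of_ne hx _ _
      refine ⟨⟨fun x hx => ?_, fun x => ?_⟩, ?_⟩
      · rcases Finset.mem_insert.1 hx with rfl | hxS
        · simp
        · rw [hoff x (by rintro rfl; exact ht hxS), h.1 x hxS]
      · obtain ⟨i, hi⟩ := h.2 x
        refine exists_iterate_mem_congr (φ := φ) (S := ((insert t S : Finset α) : Set α)) ?_
          ⟨i, Finset.mem_coe.2 (Finset.mem_insert_of_mem hi)⟩
        intro y hy
        rw [hoff y]
        rintro rfl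
        exact hy (by simp)
      -- If the old parent of `t` led back to `t`, then `t` would be periodic for the original
      -- forest, whose periodic points are all roots in `S`.
      · intro hi
        obtain ⟨j, hj⟩ := exists_iterate_mem_congr (S := {t}) hoff hi
        have hper : t ∈ Function.periodicPts φ := by
          refine ⟨j + 1, by omega, ?_⟩
          rw [Function.IsPeriodicPt, Function.IsFixedPt, Function.iterate_succ_apply]
          exact hj
        obtain ⟨k, hk⟩ := h.2 t
        exact ht (mem_of_mem_periodicPts_of_iterate_mem (S := (S : Set α))
          (fun x hx => by rw [h.1 x hx]; exact hx) hper hk)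
    · rintro ⟨φ, y⟩ h
      simp only [Finset.mem_filter, Finset.mem_univ, true_and] at h ⊢
      obtain ⟨h, hy⟩ := h
      have hoff : ∀ x, x ≠ t → Function.update φ t y x = φ x := fun x hx =>
        Function.update_of_ne hx _ _
      -- An orbit that avoids `t` is unaffected by changing the parent of `t`; this applies to `y`,
      -- so no loop arises when `t` is attached to it.
      have hreach : ∀ (i : ℕ) (x : α), φ^[i] x ∈ S → (¬∃ j, φ^[j] x = t) →
          ∃ j, (Function.update φ t y)^[j] x ∈ S := by
        intro i
        induction i with
        | zero => exact fun x hx _ => ⟨0, hx⟩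
        | succ i ih =>
          intro x hx hxt
          obtain ⟨j, hj⟩ := ih (φ x) hx fun ⟨j, hj⟩ => hxt ⟨j + 1, hj⟩
          refine ⟨j + 1, ?_⟩
          rwa [Function.iterate_succ_apply, hoff x fun h => hxt ⟨0, h⟩]
      have hyS : ∃ j, (Function.update φ t y)^[j] y ∈ S := by
        obtain ⟨i, hi⟩ := h.2 y
        refine hreach i y ?_ hy
        rcases Finset.mem_insert.1 hi with h | h
        · exact absurd ⟨i, h⟩ hy
        · exact h
      refine ⟨fun x hx => ?_, fun x => ?_⟩
      · rw [hoff x (by rintro rfl; exact ht hx), h.1 x (Finset.mem_insert_of_mem hx)]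
      · obtain ⟨i, hi⟩ := exists_iterate_mem_congr (ψ := Function.update φ t y)
          (S := ((insert t S : Finset α) : Set α)) (fun z hz => by
            rw [hoff z]
            rintro rfl
            exact hz (by simp)) (h.2 x)
        rcases Finset.mem_insert.1 (Finset.mem_coe.1 hi) with h | h
        · obtain ⟨j, hj⟩ := hyS
          refine ⟨j + (1 + i), ?_⟩
          rw [Function.iterate_add_apply, Function.iterate_add_apply, h, Function.iterate_one,
            Function.update_self]
          exact hj
        · exact ⟨i, h⟩
    · intro φ _
      simp
    · rintro ⟨φ, y⟩ h
      simp only [Finset.mem_filter, Finset.mem_univ, true_and] at h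
      have : Function.update φ t t = φ := by
        rw [Function.update_eq_self_iff, h.1.1 t (Finset.mem_insert_self _ _)]
      simp [this]
  have h2 : Fintype.card α * forestCount (insert t S) =
      (Finset.univ.filter fun q : (α → α) × α => IsForest (insert t S) q.1).card := by
    unfold forestCount
    rw [mul_comm, ← Finset.card_univ, ← Finset.card_product]
    congr 1
    ext ⟨φ, x⟩
    simp
  rw [h1, h2, treeCount, ← Finset.filter_filter, ← Finset.filter_filter, add_comm,
    Finset.card_filter_add_card_filter_not]

/-- By symmetry the tree of `t` receives the fraction `1 / (S.card + 1)` of all pairs of a forest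
and a vertex. Inserting this into `forestCount_add_treeCount` gives a recursion in the number of
roots. -/
theorem forestCount_insert {α : Type*} [Fintype α] [DecidableEq α] {S : Finset α} {t : α}
    (ht : t ∉ S) :
    (S.card + 1) * forestCount S = S.card * (Fintype.card α * forestCount (insert t S)) := by
  have h1 := forestCount_add_treeCount ht
  have h2 := sum_treeCount (insert t S)
  have h4 : (insert t S).card = S.card + 1 := Finset.card_insert_of_notMem ht
  rw [Finset.sum_congr rfl fun s hs => treeCount_eq hs (Finset.mem_insert_self t S),
    Finset.sum_const, h4, smul_eq_mul] at h2
  have h3 : forestCount S + treeCount (insert t S) t =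
      Fintype.card α * forestCount (insert t S) := by convert h1
  nlinarith

/-- Cayley's formula for rooted forests, multiplied by the number of vertices so that the exponent
stays nonnegative when every vertex is a root. The induction runs down from that case, where the
identity is the only forest. -/
theorem forestCount_mul_card {α : Type*} [Fintype α] (S : Finset α) :
    forestCount S * Fintype.card α = S.card * Fintype.card α ^ (Fintype.card α - S.card) := by
  classical
  induction hk : Fintype.card α - S.card generalizing S with
  | zero =>
    have hS : S = Finset.univ := Finset.card_eq_iff_eq_univ S |>.1 (by
      have := Finset.card_le_univ S
      omega)
    subst hS
    have h1 : forestCount (Finset.univ : Finset α) = 1 := by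
      rw [forestCount, Finset.card_eq_one]
      refine ⟨id, ?_⟩
      ext φ
      simp only [Finset.mem_filter, Finset.mem_univ, true_and, Finset.mem_singleton]
      constructor
      · intro h
        ext x
        exact h.1 x (Finset.mem_univ x)
      · rintro rfl
        exact ⟨fun _ _ => rfl, fun x => ⟨0, Finset.mem_univ _⟩⟩
    rw [h1, Finset.card_univ]
    simp
  | succ k ih =>
    have hne : S ≠ Finset.univ := by
      rintro rfl
      simp at hk
    obtain ⟨t, ht⟩ : ∃ t, t ∉ S := by
      by_contra! h
      exact hne (Finset.eq_univ_of_forall h)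
    have h4 : (insert t S).card = S.card + 1 := Finset.card_insert_of_notMem ht
    have h1 := ih (insert t S) (by omega)
    have h2 := forestCount_insert ht
    rw [h4] at h1
    refine Nat.eq_of_mul_eq_mul_left (Nat.succ_pos S.card) ?_
    rw [Nat.succ_eq_add_one, ← mul_assoc, h2, mul_comm (Fintype.card α), h1, pow_succ]
    ring

/-! ### Maps as permutations of the cyclic points glued to forests -/

theorem exists_iterate_mem_periodicPts {α : Type*} [Finite α] (φ : α → α) (x : α) :
    ∃ i, φ^[i] x ∈ Function.periodicPts φ := by
  obtain ⟨i, j, hij, h⟩ := Finite.exists_ne_map_eq_of_infinite fun i : ℕ => φ^[i] x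
  wlog hlt : i < j generalizing i j
  · exact this j i hij.symm h.symm (by omega)
  refine ⟨i, j - i, by omega, ?_⟩
  rw [Function.IsPeriodicPt, Function.IsFixedPt, ← Function.iterate_add_apply,
    Nat.sub_add_cancel hlt.le]
  exact h.symm

open scoped Classical in
/-- A map with set of cyclic points `S` is a permutation of `S` together with a forest. -/
theorem card_cyclicPoints_eq {α : Type*} [Fintype α] (m : ℕ) (P : ℝ → Prop) (S : Finset α) :
    (Finset.univ.filter fun φ : α → α => cyclicPoints φ = S ∧ P (cycleWeight m φ)).card =
      permCountOn {x // x ∈ S} m P * forestCount S := by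
  rw [permCountOn, forestCount, ← Finset.card_product]
  symm
  let glue : Equiv.Perm {x // x ∈ S} → (α → α) → α → α :=
    fun σ ψ x => if h : x ∈ S then (σ ⟨x, h⟩).1 else ψ x
  have hin : ∀ σ ψ (x : {x // x ∈ S}), glue σ ψ x.1 = (σ x).1 := fun σ ψ x => dif_pos x.2
  have hout : ∀ σ ψ x, x ∉ S → glue σ ψ x = ψ x := fun σ ψ x hx => dif_neg hx
  have hper : ∀ σ ψ (x : {x // x ∈ S}),
      Function.minimalPeriod (glue σ ψ) x.1 = Function.minimalPeriod σ x := fun σ ψ x =>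
    minimalPeriod_of_semiconj Subtype.val_injective (fun x => (hin σ ψ x).symm) x
  have hcyc : ∀ σ ψ, IsForest S ψ → cyclicPoints (glue σ ψ) = S := by
    intro σ ψ hψ
    ext x
    rw [mem_cyclicPoints]
    constructor
    · intro hx
      obtain ⟨i, hi⟩ := exists_iterate_mem_congr (S := (S : Set α)) (ψ := glue σ ψ)
        (fun z hz => (hout σ ψ z hz).symm) (hψ.2 x)
      exact mem_of_mem_periodicPts_of_iterate_mem (S := (S : Set α))
        (fun z hz => by
          have := hin σ ψ ⟨z, hz⟩
          simp only at this
          rw [this]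
          exact (σ _).2) hx hi
    · intro hx
      rw [← Function.minimalPeriod_pos_iff_mem_periodicPts, hper σ ψ ⟨x, hx⟩]
      exact Function.minimalPeriod_pos_of_mem_periodicPts (mem_periodicPts_perm σ _)
  have hw : ∀ σ ψ, IsForest S ψ → cycleWeight m (glue σ ψ) = cycleWeight m σ := by
    intro σ ψ hψ
    unfold cycleWeight
    rw [← Finset.sum_subset (Finset.subset_univ S)]
    · rw [← Finset.sum_coe_sort S]
      exact Finset.sum_congr rfl fun x _ => by rw [hper]
    · intro x _ hx
      rw [← hcyc σ ψ hψ, mem_cyclicPoints] at hx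
      rw [Function.minimalPeriod_eq_zero_of_notMem_periodicPts hx]
      simp
  refine Finset.card_bij (fun q _ => glue q.1 q.2) ?_ ?_ ?_
  · rintro ⟨σ, ψ⟩ h
    simp only [Finset.mem_product, Finset.mem_filter, Finset.mem_univ, true_and] at h ⊢
    exact ⟨hcyc σ ψ h.2, by rw [hw σ ψ h.2]; exact h.1⟩
  · rintro ⟨σ, ψ⟩ h ⟨σ', ψ'⟩ h' heq
    simp only [Finset.mem_product, Finset.mem_filter, Finset.mem_univ, true_and] at h h' heq
    rw [Prod.mk.injEq]
    constructor
    · ext x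
      rw [← hin σ ψ, heq, hin]
    · ext x
      by_cases hx : x ∈ S
      · rw [h.2.1 x hx, h'.2.1 x hx]
      · rw [← hout σ ψ x hx, heq, hout _ _ x hx]
  · intro φ hφ
    simp only [Finset.mem_filter, Finset.mem_univ, true_and] at hφ
    obtain ⟨h1, h2⟩ := hφ
    have hS : ∀ x, x ∈ S ↔ x ∈ Function.periodicPts φ := fun x => by rw [← h1, mem_cyclicPoints]
    have hbij := Function.bijOn_periodicPts φ
    have hmaps : ∀ x : {x // x ∈ S}, φ x.1 ∈ S := fun x =>
      (hS _).2 (hbij.mapsTo ((hS _).1 x.2))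
    have hinj : Function.Injective fun x : {x // x ∈ S} => (⟨φ x.1, hmaps x⟩ : {x // x ∈ S}) := by
      intro x y hxy
      exact Subtype.ext (hbij.injOn ((hS _).1 x.2) ((hS _).1 y.2) (congrArg Subtype.val hxy))
    let σ : Equiv.Perm {x // x ∈ S} := Equiv.ofBijective _ (Finite.injective_iff_bijective.1 hinj)
    let ψ : α → α := fun x => if x ∈ S then x else φ x
    have hψ : IsForest S ψ := by
      refine ⟨fun x hx => if_pos hx, fun x => ?_⟩
      obtain ⟨i, hi⟩ := exists_iterate_mem_periodicPts φ x
      exact exists_iterate_mem_congr (φ := φ) (S := (S : Set α))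
        (fun z hz => (if_neg hz : ψ z = φ z).symm) ⟨i, (hS _).2 hi⟩
    have hglue : glue σ ψ = φ := by
      ext x
      by_cases hx : x ∈ S
      · exact hin σ ψ ⟨x, hx⟩
      · rw [hout σ ψ x hx]
        exact if_neg hx
    refine ⟨(σ, ψ), ?_, hglue⟩
    simp only [Finset.mem_product, Finset.mem_filter, Finset.mem_univ, true_and]
    refine ⟨?_, hψ⟩
    rw [← hw σ ψ hψ, hglue]
    exact h2

/-- The probability that a uniform map of an `n`-element set has `k` cyclic points. -/
noncomputable def cyclicProb (n k : ℕ) : ℝ := k * n.descFactorial k / (n : ℝ) ^ (k + 1)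

open scoped Classical in
theorem card_card_cyclicPoints_eq {α : Type*} [Fintype α] (m k : ℕ) (P : ℝ → Prop) :
    (Finset.univ.filter fun φ : α → α =>
      (cyclicPoints φ).card = k ∧ P (cycleWeight m φ)).card * Fintype.card α =
      (Fintype.card α).choose k *
        (permCount k m P * (k * Fintype.card α ^ (Fintype.card α - k))) := by
  have hmaps : ∀ φ ∈ (Finset.univ.filter fun φ : α → α =>
      (cyclicPoints φ).card = k ∧ P (cycleWeight m φ)),
      cyclicPoints φ ∈ Finset.powersetCard k Finset.univ := by
    intro φ hφ
    rw [Finset.mem_powersetCard]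
    exact ⟨Finset.subset_univ _, (Finset.mem_filter.1 hφ).2.1⟩
  rw [Finset.card_eq_sum_card_fiberwise hmaps, Finset.sum_mul,
    Finset.sum_congr rfl (g := fun _ =>
      permCount k m P * (k * Fintype.card α ^ (Fintype.card α - k)))]
  · rw [Finset.sum_const, Finset.card_powersetCard, Finset.card_univ, smul_eq_mul]
  · intro S hS
    obtain ⟨-, hS⟩ := Finset.mem_powersetCard.1 hS
    have h := card_cyclicPoints_eq m P S
    rw [permCountOn_eq (n := k) (by rw [Fintype.card_coe, hS])] at h
    rw [← hS] at h ⊢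
    rw [← forestCount_mul_card, ← mul_assoc, ← h, Finset.filter_filter]
    congr 2
    ext φ
    simp only [Finset.mem_filter, Finset.mem_univ, true_and]
    constructor
    · rintro ⟨⟨h1, h2⟩, h3⟩
      exact ⟨h3, h2⟩
    · rintro ⟨h3, h2⟩
      exact ⟨⟨by rw [h3], h2⟩, h3⟩

open scoped Classical in
-- Given the number of cyclic points, the permutation induced on them is uniform, so the probability
-- factors. For `k > n` both sides vanish.
theorem card_rthLongestCycle_le {r : ℕ} (hr : 1 ≤ r) {n : ℕ} (hn : 1 ≤ n) (m k : ℕ) :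
    ((Finset.univ.filter fun φ : Fin n → Fin n =>
      (cyclicPoints φ).card = k ∧ rthLongestCycle r φ ≤ m).card : ℝ) / (n : ℝ) ^ n =
      cyclicProb n k * permProb r m k := by
  have h : (Finset.univ.filter fun φ : Fin n → Fin n =>
      (cyclicPoints φ).card = k ∧ cycleWeight m φ < r).card * Fintype.card (Fin n) =
      (Fintype.card (Fin n)).choose k * (permCount k m (fun w => w < r) *
        (k * Fintype.card (Fin n) ^ (Fintype.card (Fin n) - k))) := by
    convert card_card_cyclicPoints_eq (α := Fin n) m k (fun w => w < r)
  have h1 : (Finset.univ.filter fun φ : Fin n → Fin n =>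
      (cyclicPoints φ).card = k ∧ rthLongestCycle r φ ≤ m).card =
      (Finset.univ.filter fun φ : Fin n → Fin n =>
      (cyclicPoints φ).card = k ∧ cycleWeight m φ < r).card := by
    congr 1
    ext φ
    simp only [Finset.mem_filter, Finset.mem_univ, true_and]
    rw [rthLongestCycle_le_iff hr, cycleWeight_eq, Nat.cast_lt]
  rw [h1]
  rw [Fintype.card_fin] at h
  have hn0 : (n : ℝ) ≠ 0 := by positivity
  rcases le_or_gt k n with hk | hk
  · have h2 := congrArg (Nat.cast : ℕ → ℝ) h
    push_cast at h2
    rw [cyclicProb, permProb, Nat.descFactorial_eq_factorial_mul_choose]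
    push_cast
    have h3 : (n : ℝ) ^ n = (n : ℝ) ^ (n - k) * (n : ℝ) ^ k := by
      rw [← pow_add, Nat.sub_add_cancel hk]
    rw [h3, pow_succ]
    have h5 : (k.factorial : ℝ) ≠ 0 := by positivity
    field_simp
    rw [h2]
    ring
  · rw [Nat.choose_eq_zero_of_lt hk, zero_mul, mul_eq_zero] at h
    rw [cyclicProb, Nat.descFactorial_eq_zero_iff_lt.2 hk, h.resolve_right (by omega)]
    simp

/-! ### Uniform permutations and the generalized Dickman functions -/

theorem IsGeneralizedDickman.exists_lipschitz {ρ : ℕ → ℝ → ℝ} (hρ : IsGeneralizedDickman ρ) (r : ℕ)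
    (T : ℝ) :
    ∃ K : ℝ, 0 ≤ K ∧ ∀ s t, 0 ≤ s → s ≤ t → t ≤ T → |ρ r t - ρ r s| ≤ K * (t - s) := by
  cases r with
  | zero => exact ⟨0, le_rfl, fun s t _ _ _ => by simp [hρ.zero]⟩
  | succ r => exact ((isGeneralizedDickman_iff.1 hρ).2 r).exists_lipschitz (hρ.continuousOn r) T

/-- One step of the Euler scheme for the delay equation has an error of second order. -/
theorem IsGeneralizedDickman.exists_increment_bound {ρ : ℕ → ℝ → ℝ} (hρ : IsGeneralizedDickman ρ)
    (r : ℕ) (T : ℝ) :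
    ∃ C : ℝ, 0 ≤ C ∧ ∀ m q : ℕ, 1 ≤ m → (m + q + 1 : ℝ) ≤ T * m →
      |ρ (r + 1) ((m + q + 1) / m) - ρ (r + 1) ((m + q) / m) +
        (ρ (r + 1) (q / m) - ρ r (q / m)) / (m + q + 1)| ≤ C / m ^ 2 := by
  obtain ⟨K, hK, hKb⟩ := hρ.exists_lipschitz (r + 1) T
  obtain ⟨K', hK', hKb'⟩ := hρ.exists_lipschitz r T
  obtain ⟨M, hM⟩ := (isCompact_Icc (a := (0 : ℝ)) (b := T)).exists_bound_of_continuousOn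
    (((hρ.continuousOn (r + 1)).sub (hρ.continuousOn r)).mono Set.Icc_subset_Ici_self)
  have hu := (isGeneralizedDickman_iff.1 hρ).2 r
  refine ⟨K + K' + max M 0, by positivity, fun m q hm hq => ?_⟩
  have hm0 : (1 : ℝ) ≤ m := by exact_mod_cast hm
  have hm' : (0 : ℝ) < m := by linarith
  have hq0 : (0 : ℝ) ≤ q := Nat.cast_nonneg q
  set a : ℝ := (m + q) / m with ha
  set b : ℝ := (m + q + 1) / m with hb
  have hba : b - a = 1 / m := by rw [ha, hb]; field_simp; ring
  have ha1 : 1 ≤ a := by rw [ha, one_le_div hm']; linarith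
  have hab : a < b := by have : (0 : ℝ) < 1 / m := by positivity
                         linarith
  have hbT : b ≤ T := by rw [hb, div_le_iff₀ hm']; exact hq
  have hqa : (q : ℝ) / m = a - 1 := by rw [ha]; field_simp; ring
  -- The increment is `1/m` times the derivative at some `c` in `(a, b)`, whereas the scheme takes
  -- the delayed values at `a - 1` and the factor `1/b`. Both discrepancies are `O(1/m)`, by the
  -- Lipschitz bounds and by `b, c ≥ 1`.
  obtain ⟨c, hc, hc'⟩ := exists_hasDerivAt_eq_slope (ρ (r + 1)) _ hab
    (hu.continuousOn.mono fun x hx => le_trans (by linarith) hx.1)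
    (fun x hx => hu.hasDerivAt (ha1.trans_lt hx.1))
  rw [eq_div_iff (by linarith)] at hc'
  have hc1 : 1 < c := ha1.trans_lt hc.1
  have hb1 : 1 < b := ha1.trans_lt hab
  have hden : (m + q + 1 : ℝ) = b * m := by rw [hb]; field_simp
  rw [hqa, ← hc', hden, hba]
  set D : ℝ → ℝ := fun x => ρ (r + 1) x - ρ r x with hD
  have hL : |D (c - 1) - D (a - 1)| ≤ (K + K') * (1 / m) := by
    have h1 := hKb (a - 1) (c - 1) (by linarith) (by linarith [hc.1]) (by linarith [hc.2])
    have h2 := hKb' (a - 1) (c - 1) (by linarith) (by linarith [hc.1]) (by linarith [hc.2])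
    have h3 : c - 1 - (a - 1) ≤ 1 / m := by linarith [hc.2]
    have h4 : D (c - 1) - D (a - 1) = (ρ (r + 1) (c - 1) - ρ (r + 1) (a - 1)) -
      (ρ r (c - 1) - ρ r (a - 1)) := by rw [hD]; ring
    rw [h4]
    calc _ ≤ _ := abs_sub _ _
      _ ≤ K * (c - 1 - (a - 1)) + K' * (c - 1 - (a - 1)) := add_le_add h1 h2
      _ = (K + K') * (c - 1 - (a - 1)) := by ring
      _ ≤ _ := by gcongr
  have hMb : |D (a - 1)| ≤ max M 0 :=
    (hM (a - 1) ⟨by linarith, by linarith⟩).trans (le_max_left _ _)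
  have hinv : |1 / b - 1 / c| ≤ 1 / m := by
    have h1 : 1 / b - 1 / c = -((b - c) / (b * c)) := by field_simp; ring
    have hbc : 1 ≤ b * c := by nlinarith
    rw [h1, abs_neg, abs_of_nonneg (div_nonneg (by linarith [hc.2]) (by linarith))]
    refine (div_le_self (by linarith [hc.2]) hbc).trans ?_
    linarith [hc.1]
  have heq : -(ρ (r + 1) (c - 1) - ρ r (c - 1)) / c * (1 / m) +
      (ρ (r + 1) (a - 1) - ρ r (a - 1)) / (b * m) =
      (1 / m) * (D (a - 1) * (1 / b - 1 / c) - (D (c - 1) - D (a - 1)) / c) := by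
    rw [hD]; field_simp; ring
  rw [heq, abs_mul, abs_of_pos (by positivity : (0 : ℝ) < 1 / m)]
  have h5 : |(D (c - 1) - D (a - 1)) / c| ≤ (K + K') * (1 / m) := by
    rw [abs_div, abs_of_pos (by linarith : 0 < c)]
    exact (div_le_self (abs_nonneg _) hc1.le).trans hL
  have h6 : |D (a - 1) * (1 / b - 1 / c)| ≤ max M 0 * (1 / m) := by
    rw [abs_mul]
    exact mul_le_mul hMb hinv (abs_nonneg _) (le_max_right _ _)
  calc _ ≤ 1 / m * (max M 0 * (1 / m) + (K + K') * (1 / m)) := by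
        gcongr
        exact (abs_sub _ _).trans (add_le_add h6 h5)
    _ = _ := by field_simp; ring

/-- The probabilities satisfy the Euler scheme exactly and `ρ` satisfies it up to `O(1/m²)`, so
`O(m)` steps accumulate an error `O(1/m)`. A step uses values one unit of `ξ` earlier, for the
indices `r + 1` and `r`, which is why the induction is on `T` inside an induction on `r`. -/
theorem IsGeneralizedDickman.exists_permProb_bound {ρ : ℕ → ℝ → ℝ} (hρ : IsGeneralizedDickman ρ)
    (r T : ℕ) :
    ∃ B : ℝ, 0 ≤ B ∧ ∀ m k : ℕ, 1 ≤ m → k ≤ T * m →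
      |permProb r m k - ρ r (k / m)| ≤ B / m := by
  induction r generalizing T with
  | zero => exact ⟨0, le_rfl, fun m k _ _ => by simp [permProb_zero, hρ.zero]⟩
  | succ r ihr =>
    have hu := (isGeneralizedDickman_iff.1 hρ).2 r
    have hsmall : ∀ m k : ℕ, 1 ≤ m → k ≤ m →
        permProb (r + 1) m k - ρ (r + 1) (k / m) = 0 := by
      intro m k hm hk
      have hm' : (0 : ℝ) < m := by exact_mod_cast hm
      rw [permProb_of_le (by omega) hk, hu.eq_one _ (by positivity)
        (by rw [div_le_one hm']; exact_mod_cast hk), sub_self]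
    induction T with
    | zero =>
      refine ⟨0, le_rfl, fun m k hm hk => ?_⟩
      rw [hsmall m k hm (by omega)]
      simp
    | succ T ihT =>
      obtain ⟨B1, hB1, h1⟩ := ihT
      obtain ⟨B0, hB0, h0⟩ := ihr T
      obtain ⟨C, hC, hinc⟩ := hρ.exists_increment_bound r (T + 1)
      have claim : ∀ m q : ℕ, 1 ≤ m → q ≤ T * m →
          |permProb (r + 1) m (m + q) - ρ (r + 1) ((m + q) / m)| ≤
            q * (C + B1 + B0) / m ^ 2 := by
        intro m q hm hq
        have hm' : (0 : ℝ) < m := by exact_mod_cast hm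
        induction q with
        | zero =>
          have := hsmall m m hm le_rfl
          simp only [add_zero, Nat.cast_zero] at this ⊢
          rw [this]
          simp
        | succ q ihq =>
          have hq' : q ≤ T * m := by omega
          have e1 := h1 m q hm hq'
          have e0 := h0 m q hm hq'
          have ei := hinc m q hm (by
            have : ((q + 1 : ℕ) : ℝ) ≤ ((T * m : ℕ) : ℝ) := by exact_mod_cast hq
            push_cast at this
            linarith)
          have eq := ihq hq'
          have es := permProb_sub r hm q
          have hpos : (0 : ℝ) < m + q + 1 := by positivity
          have es' : permProb (r + 1) m (m + q + 1) - permProb (r + 1) m (m + q) =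
              -(permProb (r + 1) m q - permProb r m q) / (m + q + 1) := by
            rw [eq_div_iff hpos.ne']
            push_cast at es
            linarith
          -- New error: the previous error, minus the local error of the scheme, minus the delayed
          -- errors divided by `m + q + 1`. The last two are at most `C / m ^ 2` and `(B1 + B0) / m
          -- ^ 2`.
          have hdec : permProb (r + 1) m (m + (q + 1)) - ρ (r + 1) ((m + (q + 1 : ℕ)) / m) =
              (permProb (r + 1) m (m + q) - ρ (r + 1) ((m + q) / m)) -
              (ρ (r + 1) ((m + q + 1) / m) - ρ (r + 1) ((m + q) / m) +
                (ρ (r + 1) (q / m) - ρ r (q / m)) / (m + q + 1)) -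
              ((permProb (r + 1) m q - ρ (r + 1) (q / m)) - (permProb r m q - ρ r (q / m))) /
                (m + q + 1) := by
            rw [← add_assoc]
            push_cast
            rw [← add_assoc]
            linear_combination es'
          have elast : |((permProb (r + 1) m q - ρ (r + 1) (q / m)) -
              (permProb r m q - ρ r (q / m))) / (m + q + 1)| ≤ (B1 + B0) / m ^ 2 := by
            rw [abs_div, abs_of_pos hpos]
            calc _ ≤ (B1 / m + B0 / m) / (m + q + 1) := by
                  gcongr
                  exact (abs_sub _ _).trans (add_le_add e1 e0)
              _ ≤ (B1 / m + B0 / m) / m := by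
                  gcongr
                  have : (0 : ℝ) ≤ q := Nat.cast_nonneg q
                  linarith
              _ = _ := by field_simp
          rw [hdec]
          calc _ ≤ _ := abs_sub _ _
            _ ≤ (q * (C + B1 + B0) / m ^ 2 + C / m ^ 2) + (B1 + B0) / m ^ 2 :=
                add_le_add ((abs_sub _ _).trans (add_le_add eq ei)) elast
            _ = _ := by push_cast; ring
      refine ⟨T * (C + B1 + B0), by positivity, fun m k hm hk => ?_⟩
      have hm' : (0 : ℝ) < m := by exact_mod_cast hm
      rcases le_total k m with hkm | hkm
      · rw [hsmall m k hm hkm, abs_zero]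
        positivity
      · obtain ⟨q, rfl⟩ := Nat.exists_eq_add_of_le hkm
        have hq : q ≤ T * m := by
          rw [Nat.add_mul, one_mul] at hk
          omega
        have hq' : (q : ℝ) ≤ T * m := by exact_mod_cast hq
        have := claim m q hm hq
        push_cast
        refine this.trans ?_
        calc (q : ℝ) * (C + B1 + B0) / m ^ 2 ≤ (T * m) * (C + B1 + B0) / m ^ 2 := by gcongr
          _ = _ := by field_simp

theorem IsGeneralizedDickman.continuousAt {ρ : ℕ → ℝ → ℝ} (hρ : IsGeneralizedDickman ρ) (r : ℕ)
    {ξ : ℝ} (hξ : 0 < ξ) : ContinuousAt (ρ r) ξ :=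
  (hρ.continuousOn r).continuousAt (Ici_mem_nhds hξ)

theorem IsGeneralizedDickman.tendsto_permProb {ρ : ℕ → ℝ → ℝ} (hρ : IsGeneralizedDickman ρ) (r : ℕ)
    {ι : Type*} {l : Filter ι} {k m : ι → ℕ} {ξ : ℝ} (hξ : 0 < ξ) (hm : Tendsto m l atTop)
    (hk : Tendsto (fun i => (k i : ℝ) / m i) l (𝓝 ξ)) :
    Tendsto (fun i => permProb r (m i) (k i)) l (𝓝 (ρ r ξ)) := by
  obtain ⟨T, hT⟩ := exists_nat_gt ξ
  obtain ⟨B, hB, hb⟩ := hρ.exists_permProb_bound r T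
  have h1 : Tendsto (fun i => ρ r ((k i : ℝ) / m i)) l (𝓝 (ρ r ξ)) :=
    (hρ.continuousAt r hξ).tendsto.comp hk
  have h2 : Tendsto (fun i => B / (m i : ℝ)) l (𝓝 0) :=
    (tendsto_const_div_atTop_nhds_zero_nat B).comp hm
  have h3 : Tendsto (fun i => permProb r (m i) (k i) - ρ r ((k i : ℝ) / m i)) l (𝓝 0) := by
    refine squeeze_zero_norm' ?_ h2
    filter_upwards [hm.eventually_ge_atTop 1, hk.eventually_lt_const hT] with i hi hki
    refine hb _ _ hi ?_
    have hm' : (0 : ℝ) < m i := by exact_mod_cast hi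
    rw [div_lt_iff₀ hm'] at hki
    exact_mod_cast hki.le
  simpa using h3.add h1

theorem IsGeneralizedDickman.tendsto_permProb_floor {ρ : ℕ → ℝ → ℝ} (hρ : IsGeneralizedDickman ρ)
    (r : ℕ) {ξ : ℝ} (hξ : 0 < ξ) :
    Tendsto (fun m : ℕ => permProb r m ⌊ξ * m⌋₊) atTop (𝓝 (ρ r ξ)) :=
  hρ.tendsto_permProb r hξ tendsto_id
    ((tendsto_nat_floor_mul_div_atTop hξ.le).comp tendsto_natCast_atTop_atTop)

/-- This bound, the upper bound and the monotonicity in `r` pass to the limit from the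
probabilities; they are not visible in the delay equation itself. -/
theorem IsGeneralizedDickman.nonneg {ρ : ℕ → ℝ → ℝ} (hρ : IsGeneralizedDickman ρ) (r : ℕ) {ξ : ℝ}
    (hξ : 0 < ξ) : 0 ≤ ρ r ξ :=
  ge_of_tendsto' (hρ.tendsto_permProb_floor r hξ) fun _ => permProb_nonneg _ _ _

theorem IsGeneralizedDickman.le_one {ρ : ℕ → ℝ → ℝ} (hρ : IsGeneralizedDickman ρ) (r : ℕ) {ξ : ℝ}
    (hξ : 0 < ξ) : ρ r ξ ≤ 1 :=
  le_of_tendsto' (hρ.tendsto_permProb_floor r hξ) fun _ => permProb_le_one _ _ _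

theorem IsGeneralizedDickman.le_succ {ρ : ℕ → ℝ → ℝ} (hρ : IsGeneralizedDickman ρ) (r : ℕ) {ξ : ℝ}
    (hξ : 0 < ξ) : ρ r ξ ≤ ρ (r + 1) ξ :=
  le_of_tendsto_of_tendsto' (hρ.tendsto_permProb_floor r hξ)
    (hρ.tendsto_permProb_floor (r + 1) hξ) fun _ => permProb_mono (Nat.le_succ r) _ _

theorem IsGeneralizedDickman.antitoneOn {ρ : ℕ → ℝ → ℝ} (hρ : IsGeneralizedDickman ρ) (r : ℕ) :
    AntitoneOn (ρ (r + 1)) (Set.Ici 1) := by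
  have hu := (isGeneralizedDickman_iff.1 hρ).2 r
  refine antitoneOn_of_deriv_nonpos (convex_Ici 1)
    (hu.continuousOn.mono (Set.Ici_subset_Ici.2 zero_le_one)) ?_ ?_
  · intro x hx
    rw [interior_Ici] at hx
    exact (hu.differentiableAt x hx).differentiableWithinAt
  · intro x hx
    rw [interior_Ici, Set.mem_Ioi] at hx
    rw [(hu.hasDerivAt hx).deriv]
    have := hρ.le_succ r (ξ := x - 1) (by linarith)
    exact div_nonpos_of_nonpos_of_nonneg (by linarith) (by linarith)

/-- By monotonicity it suffices to fall below each `ε` once. If `ρ (r + 1)` stayed above `ε` while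
`ρ r` is below `ε / 2`, its derivative would be at most `-(ε / 2) / ξ`, and the divergence of the
logarithm would make it negative. -/
theorem IsGeneralizedDickman.tendsto_atTop {ρ : ℕ → ℝ → ℝ} (hρ : IsGeneralizedDickman ρ) (r : ℕ) :
    Tendsto (ρ r) atTop (𝓝 0) := by
  induction r with
  | zero => rw [hρ.zero]; exact tendsto_const_nhds
  | succ r ih =>
    have hu := (isGeneralizedDickman_iff.1 hρ).2 r
    have hanti := hρ.antitoneOn r
    have key : ∀ ε > 0, ∃ ξ, 1 ≤ ξ ∧ ρ (r + 1) ξ < ε := by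
      intro ε hε
      by_contra! hcon
      obtain ⟨X, hX⟩ := eventually_atTop.1 (ih.eventually_lt_const (half_pos hε))
      set Y := max X 1 + 1 with hY
      have hX1 : (1 : ℝ) ≤ max X 1 := le_max_right _ _
      have hXX : X ≤ max X 1 := le_max_left _ _
      have hmono : AntitoneOn (fun ξ => ρ (r + 1) ξ + ε / 2 * Real.log ξ) (Set.Ici Y) := by
        have hder : ∀ x, Y ≤ x → HasDerivAt (fun ξ => ρ (r + 1) ξ + ε / 2 * Real.log ξ)
            (-(ρ (r + 1) (x - 1) - ρ r (x - 1)) / x + ε / 2 * x⁻¹) x := fun x hx =>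
          (hu.hasDerivAt (by linarith)).add
            ((Real.hasDerivAt_log (by linarith : x ≠ 0)).const_mul _)
        refine antitoneOn_of_deriv_nonpos (convex_Ici Y)
          (fun x hx => (hder x hx).continuousAt.continuousWithinAt) ?_ ?_
        · intro x hx
          exact (hder x (interior_subset hx)).differentiableAt.differentiableWithinAt
        · intro x hx
          have hx' : Y ≤ x := interior_subset hx
          rw [(hder x hx').deriv, ← div_eq_mul_inv, ← add_div]
          have h1 := hcon (x - 1) (by linarith)
          have h2 := hX (x - 1) (by linarith)
          exact div_nonpos_of_nonpos_of_nonneg (by linarith) (by linarith)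
      have hlog := (Real.tendsto_log_atTop.const_mul_atTop (half_pos hε)).eventually_gt_atTop
        (ρ (r + 1) Y + ε / 2 * Real.log Y)
      obtain ⟨x, hx1, hx2⟩ := (hlog.and (eventually_ge_atTop Y)).exists
      have h3 := hmono (Set.mem_Ici.2 le_rfl) (Set.mem_Ici.2 hx2) hx2
      have h4 := hρ.nonneg (r + 1) (ξ := x) (by linarith)
      simp only at h3
      linarith
    rw [Metric.tendsto_atTop]
    intro ε hε
    obtain ⟨ξ, h1, h2⟩ := key ε hε
    refine ⟨ξ, fun x hx => ?_⟩
    rw [Real.dist_eq, sub_zero, abs_of_nonneg (hρ.nonneg _ (by linarith))]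
    exact (hanti (Set.mem_Ici.2 h1) (Set.mem_Ici.2 (h1.trans hx)) hx).trans_lt h2

/-! ### The limiting density -/

theorem IsGeneralizedDickman.measurable {ρ : ℕ → ℝ → ℝ} (hρ : IsGeneralizedDickman ρ) (r : ℕ) :
    Measurable (ρ r) := by
  cases r with
  | zero => rw [hρ.zero]; exact measurable_const
  | succ r =>
    have hu := (isGeneralizedDickman_iff.1 hρ).2 r
    have hc : Continuous fun ξ : ℝ => ρ (r + 1) (max ξ 0) :=
      hu.continuousOn.comp_continuous (by fun_prop) fun ξ => Set.mem_Ici.2 (le_max_right _ _)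
    have h : ρ (r + 1) = (Set.Ici (0 : ℝ)).indicator fun ξ => ρ (r + 1) (max ξ 0) := by
      ext ξ
      by_cases h0 : 0 ≤ ξ
      · rw [Set.indicator_of_mem (Set.mem_Ici.2 h0), max_eq_left h0]
      · rw [Set.indicator_of_notMem (by simpa using h0), hu.eq_zero_of_neg _ (by linarith)]
    rw [h]
    exact hc.measurable.indicator measurableSet_Ici

theorem IsGeneralizedDickman.measurable_jointDensity {ρ : ℕ → ℝ → ℝ}
    (hρ : IsGeneralizedDickman ρ) (r : ℕ) :
    Measurable fun p : ℝ × ℝ => jointDensity ρ r p.1 p.2 := by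
  have h1 := hρ.measurable r
  have h2 := hρ.measurable (r - 1)
  unfold jointDensity
  refine Measurable.ite ?_ ?_ measurable_const
  · exact (measurableSet_lt measurable_const measurable_fst).inter
      (measurableSet_lt measurable_fst measurable_snd)
  · have h3 : Measurable fun p : ℝ × ℝ => (p.2 - p.1) / p.1 := by fun_prop
    have h4 := h1.comp h3
    have h5 := h2.comp h3
    simp only [Function.comp_def] at h4 h5
    fun_prop

theorem IsGeneralizedDickman.jointDensity_nonneg {ρ : ℕ → ℝ → ℝ} (hρ : IsGeneralizedDickman ρ)
    {r : ℕ} (hr : 1 ≤ r) (l ν : ℝ) : 0 ≤ jointDensity ρ r l ν := by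
  obtain ⟨s, rfl⟩ := Nat.exists_eq_add_of_le' hr
  unfold jointDensity
  split_ifs with h
  · have h1 := hρ.le_succ s (ξ := (ν - l) / l) (div_pos (by linarith) h.1)
    have hν : 0 < ν := h.1.trans h.2
    have hl := h.1
    rw [Nat.add_sub_cancel]
    exact mul_nonneg (by positivity) (by linarith)
  · exact le_rfl

theorem IsGeneralizedDickman.antitoneOn_Ioi {ρ : ℕ → ℝ → ℝ} (hρ : IsGeneralizedDickman ρ) (r : ℕ) :
    AntitoneOn (ρ (r + 1)) (Set.Ioi 0) := by
  have hu := (isGeneralizedDickman_iff.1 hρ).2 r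
  intro s hs t ht hst
  rcases le_total s 1 with h | h
  · rw [hu.eq_one s (Set.mem_Ioi.1 hs).le h]
    exact hρ.le_one _ ht
  · exact hρ.antitoneOn r (Set.mem_Ici.2 h) (Set.mem_Ici.2 (h.trans hst)) hst

/-- The Rayleigh density times the limiting distribution function, given `ν` cyclic points, of the
length of the `r`-th longest cycle. -/
noncomputable def partialDensity (ρ : ℕ → ℝ → ℝ) (r : ℕ) (x ν : ℝ) : ℝ :=
  ν * Real.exp (-ν ^ 2 / 2) * ρ r (ν / x)

/-- For `l < ν` this is the chain rule and the delay equation at `ν / l > 1`; for `l > ν` the factor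
`ρ r (ν / l)` is locally constant. The point `l = ν` corresponds to `ξ = 1`, where no derivative is
prescribed. -/
theorem IsGeneralizedDickman.hasDerivAt_partialDensity {ρ : ℕ → ℝ → ℝ}
    (hρ : IsGeneralizedDickman ρ) {r : ℕ} (hr : 1 ≤ r) {l ν : ℝ} (hl : 0 < l) (hν : 0 < ν)
    (hne : l ≠ ν) :
    HasDerivAt (fun x => partialDensity ρ r x ν) (jointDensity ρ r l ν) l := by
  obtain ⟨s, rfl⟩ := Nat.exists_eq_add_of_le' hr
  have hu := (isGeneralizedDickman_iff.1 hρ).2 s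
  unfold partialDensity jointDensity
  rcases hne.lt_or_gt with h | h
  · have h1 : 1 < ν / l := by rwa [one_lt_div hl]
    have hd : HasDerivAt (fun x : ℝ => ν / x) (-ν / l ^ 2) l := by
      simpa [div_eq_mul_inv] using (hasDerivAt_inv hl.ne').const_mul ν
    have h2 := ((hu.hasDerivAt h1).comp l hd).const_mul (ν * Real.exp (-ν ^ 2 / 2))
    refine h2.congr_deriv ?_
    rw [if_pos ⟨hl, h⟩, Nat.add_sub_cancel]
    have h3 : ν / l - 1 = (ν - l) / l := by field_simp
    rw [h3]
    field_simp
  · rw [if_neg (by intro h'; linarith [h'.2])]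
    refine (hasDerivAt_const l (ν * Real.exp (-ν ^ 2 / 2))).congr_of_eventuallyEq ?_
    filter_upwards [eventually_gt_nhds h] with x hx
    have hx0 : 0 < x := hν.trans hx
    rw [hu.eq_one _ (by positivity) (by rw [div_le_one hx0]; exact hx.le), mul_one]

theorem IsGeneralizedDickman.jointDensity_le {ρ : ℕ → ℝ → ℝ} (hρ : IsGeneralizedDickman ρ) {r : ℕ}
    {x l ν : ℝ} (hx : 0 < x) (hxl : x ≤ l) (hν : 0 < ν) :
    jointDensity ρ r l ν ≤ ν / x * Real.exp (-ν ^ 2 / 2) := by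
  unfold jointDensity
  split_ifs with h
  · have hpos : 0 < (ν - l) / l := div_pos (by linarith) h.1
    have h1 := hρ.le_one r hpos
    have h2 := hρ.nonneg (r - 1) hpos
    calc _ ≤ ν / l * Real.exp (-ν ^ 2 / 2) * 1 := by
          have hl := h.1
          gcongr
          linarith
      _ ≤ _ := by rw [mul_one]; gcongr
  · positivity

theorem IsGeneralizedDickman.integral_jointDensity {ρ : ℕ → ℝ → ℝ} (hρ : IsGeneralizedDickman ρ)
    {r : ℕ} (hr : 1 ≤ r) {x₁ x₂ ν : ℝ} (h1 : 0 < x₁) (h12 : x₁ ≤ x₂) (hν : 0 < ν) :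
    ∫⁻ l in Set.Ioc x₁ x₂, ENNReal.ofReal (jointDensity ρ r l ν) =
      ENNReal.ofReal (partialDensity ρ r x₂ ν - partialDensity ρ r x₁ ν) := by
  have hmeas : Measurable fun l => jointDensity ρ r l ν :=
    (hρ.measurable_jointDensity r).comp (by fun_prop : Measurable fun l : ℝ => (l, ν))
  have hint : IntegrableOn (fun l => jointDensity ρ r l ν) (Set.Ioc x₁ x₂) := by
    refine Measure.integrableOn_of_bounded (M := ν / x₁ * Real.exp (-ν ^ 2 / 2))
      (by simp) hmeas.aestronglyMeasurable ?_
    filter_upwards [ae_restrict_mem measurableSet_Ioc] with l hl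
    rw [Real.norm_of_nonneg (hρ.jointDensity_nonneg hr _ _)]
    exact hρ.jointDensity_le h1 hl.1.le hν
  rw [← ofReal_integral_eq_lintegral_ofReal hint
    (ae_of_all _ fun l => hρ.jointDensity_nonneg hr l ν), ← intervalIntegral.integral_of_le h12]
  congr 1
  -- At the exceptional point `l = ν` continuity is enough for the fundamental theorem of calculus.
  refine integral_eq_of_hasDerivAt_off_countable
    (fun x => partialDensity ρ r x ν) _ (Set.countable_singleton ν) ?_ ?_ ?_
  · rw [Set.uIcc_of_le h12]
    intro x hx
    have hx0 : 0 < x := h1.trans_le hx.1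
    refine ContinuousAt.continuousWithinAt ?_
    unfold partialDensity
    refine continuousAt_const.mul ?_
    exact ContinuousAt.comp (hρ.continuousAt r (div_pos hν hx0))
      (continuousAt_const.div continuousAt_id hx0.ne')
  · rintro x ⟨hx, hxν⟩
    rw [min_eq_left h12, max_eq_right h12] at hx
    exact hρ.hasDerivAt_partialDensity hr (h1.trans hx.1) hν hxν
  · exact (intervalIntegrable_iff_integrableOn_Ioc_of_le h12).2 hint

/-- The measure with density `jointDensity ρ r`. -/
noncomputable def limitMeasure (ρ : ℕ → ℝ → ℝ) (r : ℕ) : Measure (ℝ × ℝ) :=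
  (volume : Measure (ℝ × ℝ)).withDensity fun p => ENNReal.ofReal (jointDensity ρ r p.1 p.2)

theorem IsGeneralizedDickman.limitMeasure_box {ρ : ℕ → ℝ → ℝ} (hρ : IsGeneralizedDickman ρ)
    {r : ℕ} (hr : 1 ≤ r) {x₁ x₂ y₁ y₂ : ℝ} (h1 : 0 < x₁) (h12 : x₁ ≤ x₂) (hy : 0 ≤ y₁) :
    limitMeasure ρ r (Set.Ioc x₁ x₂ ×ˢ Set.Ioc y₁ y₂) =
      ∫⁻ ν in Set.Ioc y₁ y₂,
        ENNReal.ofReal (partialDensity ρ r x₂ ν - partialDensity ρ r x₁ ν) := by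
  rw [limitMeasure, withDensity_apply _ (measurableSet_Ioc.prod measurableSet_Ioc),
    Measure.volume_eq_prod, ← Measure.prod_restrict,
    lintegral_prod_symm' _ (hρ.measurable_jointDensity r).ennreal_ofReal]
  refine setLIntegral_congr_fun measurableSet_Ioc fun ν hν => ?_
  exact hρ.integral_jointDensity hr h1 h12 (hy.trans_lt hν.1)

/-- The integral over `(x₁, x₂]` telescopes to `partialDensity`. As `x₂ → ∞` the factor `ρ r (ν /
x₂)` becomes `1`, and as `x₁ → 0` the factor `ρ r (ν / x₁)` tends to `0`, so the Rayleigh density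
remains. -/
theorem IsGeneralizedDickman.lintegral_jointDensity {ρ : ℕ → ℝ → ℝ} (hρ : IsGeneralizedDickman ρ)
    {r : ℕ} (hr : 1 ≤ r) {ν : ℝ} (hν : 0 < ν) :
    ∫⁻ l, ENNReal.ofReal (jointDensity ρ r l ν) =
      ENNReal.ofReal (ν * Real.exp (-ν ^ 2 / 2)) := by
  have hmeas : Measurable fun l => jointDensity ρ r l ν :=
    (hρ.measurable_jointDensity r).comp (by fun_prop : Measurable fun l : ℝ => (l, ν))
  let s : ℕ → Set ℝ := fun j => Set.Ioc (1 / ((j : ℝ) + 1)) ((j : ℝ) + 1)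
  have hs : Monotone s := fun i j hij => by
    have : (i : ℝ) ≤ j := by exact_mod_cast hij
    exact Set.Ioc_subset_Ioc (one_div_le_one_div_of_le (by positivity) (by linarith))
      (by linarith)
  have hU : ⋃ j, s j = Set.Ioi 0 := by
    ext x
    simp only [Set.mem_iUnion, Set.mem_Ioi]
    constructor
    · rintro ⟨j, hj⟩
      exact lt_trans (by positivity) hj.1
    · intro hx
      obtain ⟨i, hi⟩ := exists_nat_one_div_lt hx
      obtain ⟨j, hj⟩ := exists_nat_ge x
      refine ⟨max i j, ?_, ?_⟩
      · refine lt_of_le_of_lt ?_ hi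
        have : (i : ℝ) ≤ (max i j : ℕ) := by exact_mod_cast le_max_left i j
        exact one_div_le_one_div_of_le (by positivity) (by linarith)
      · have : (j : ℝ) ≤ (max i j : ℕ) := by exact_mod_cast le_max_right i j
        linarith
  have h1 := tendsto_measure_iUnion_atTop
    (μ := volume.withDensity fun l => ENNReal.ofReal (jointDensity ρ r l ν)) hs
  rw [hU, withDensity_apply _ measurableSet_Ioi] at h1
  have h2 : ∫⁻ l in Set.Ioi 0, ENNReal.ofReal (jointDensity ρ r l ν) =
      ∫⁻ l, ENNReal.ofReal (jointDensity ρ r l ν) := by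
    rw [← lintegral_indicator measurableSet_Ioi]
    congr 1
    ext l
    by_cases hl : 0 < l
    · rw [Set.indicator_of_mem (Set.mem_Ioi.2 hl)]
    · rw [Set.indicator_of_notMem (by simpa using hl), jointDensity, if_neg fun h => hl h.1]
      simp
  rw [h2] at h1
  refine tendsto_nhds_unique h1 ?_
  have h3 : ∀ j : ℕ, (volume.withDensity fun l => ENNReal.ofReal (jointDensity ρ r l ν)) (s j) =
      ENNReal.ofReal (partialDensity ρ r (j + 1) ν - partialDensity ρ r (1 / (j + 1)) ν) := by
    intro j
    rw [withDensity_apply _ measurableSet_Ioc, hρ.integral_jointDensity hr (by positivity) ?_ hν]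
    rw [div_le_iff₀ (by positivity)]
    have : (0 : ℝ) ≤ j := Nat.cast_nonneg j
    nlinarith
  simp only [Function.comp_def, h3]
  refine ENNReal.tendsto_ofReal ?_
  have hj : Tendsto (fun j : ℕ => (j : ℝ) + 1) atTop atTop :=
    tendsto_atTop_add_const_right _ _ tendsto_natCast_atTop_atTop
  have h4 : Tendsto (fun j : ℕ => ρ r (ν / ((j : ℝ) + 1))) atTop (𝓝 1) := by
    refine tendsto_const_nhds.congr' ?_
    filter_upwards [hj.eventually_ge_atTop ν] with j hj
    obtain ⟨t, rfl⟩ := Nat.exists_eq_add_of_le' hr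
    rw [((isGeneralizedDickman_iff.1 hρ).2 t).eq_one _ (by positivity)
      (by rw [div_le_one (by positivity)]; exact hj)]
  have h5 : Tendsto (fun j : ℕ => ρ r (ν / (1 / ((j : ℝ) + 1)))) atTop (𝓝 0) := by
    refine (hρ.tendsto_atTop r).comp ?_
    simp only [div_div_eq_mul_div, div_one]
    exact hj.const_mul_atTop hν
  have h6 := (h4.sub h5).const_mul (ν * Real.exp (-ν ^ 2 / 2))
  simpa [partialDensity, mul_sub] using h6

theorem hasDerivAt_neg_exp_neg_sq_div_two (ν : ℝ) :
    HasDerivAt (fun ν : ℝ => -Real.exp (-ν ^ 2 / 2)) (ν * Real.exp (-ν ^ 2 / 2)) ν := by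
  have h1 : HasDerivAt (fun ν : ℝ => -ν ^ 2 / 2) (-ν) ν :=
    (((hasDerivAt_pow 2 ν).neg).div_const 2).congr_deriv (by simp; ring)
  exact h1.exp.neg.congr_deriv (by ring)

theorem lintegral_rayleigh :
    ∫⁻ ν in Set.Ioi (0 : ℝ), ENNReal.ofReal (ν * Real.exp (-ν ^ 2 / 2)) = 1 := by
  have hlim : Tendsto (fun ν : ℝ => -Real.exp (-ν ^ 2 / 2)) atTop (𝓝 0) := by
    rw [← neg_zero]
    refine (Real.tendsto_exp_atBot.comp ?_).neg
    simp only [neg_div]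
    exact tendsto_neg_atTop_atBot.comp ((tendsto_pow_atTop two_ne_zero).atTop_div_const two_pos)
  have hd := fun (ν : ℝ) (_ : ν ∈ Set.Ici 0) => hasDerivAt_neg_exp_neg_sq_div_two ν
  have hnn : ∀ ν ∈ Set.Ioi (0 : ℝ), 0 ≤ ν * Real.exp (-ν ^ 2 / 2) := fun ν hν =>
    mul_nonneg (Set.mem_Ioi.1 hν).le (Real.exp_nonneg _)
  have hint := integrableOn_Ioi_deriv_of_nonneg' hd hnn hlim
  rw [← ofReal_integral_eq_lintegral_ofReal hint ((ae_restrict_iff' measurableSet_Ioi).2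
    (ae_of_all _ hnn)), integral_Ioi_of_hasDerivAt_of_nonneg' hd hnn hlim]
  simp

theorem IsGeneralizedDickman.isProbabilityMeasure_limitMeasure {ρ : ℕ → ℝ → ℝ}
    (hρ : IsGeneralizedDickman ρ) {r : ℕ} (hr : 1 ≤ r) :
    IsProbabilityMeasure (limitMeasure ρ r) := by
  constructor
  rw [limitMeasure, withDensity_apply _ MeasurableSet.univ, Measure.restrict_univ,
    Measure.volume_eq_prod, lintegral_prod_symm' _ (hρ.measurable_jointDensity r).ennreal_ofReal,
    ← lintegral_rayleigh, ← lintegral_indicator measurableSet_Ioi]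
  congr 1
  ext ν
  by_cases hν : 0 < ν
  · rw [Set.indicator_of_mem (Set.mem_Ioi.2 hν)]
    exact hρ.lintegral_jointDensity hr hν
  · rw [Set.indicator_of_notMem (by simpa using hν)]
    have : ∀ l, jointDensity ρ r l ν = 0 := fun l =>
      if_neg fun h => hν (h.1.trans h.2)
    simp [this]

theorem limitMeasure_compl_quadrant (ρ : ℕ → ℝ → ℝ) (r : ℕ) :
    limitMeasure ρ r (Set.Ioi 0 ×ˢ Set.Ioi 0)ᶜ = 0 := by
  rw [limitMeasure, withDensity_apply _ (measurableSet_Ioi.prod measurableSet_Ioi).compl]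
  refine setLIntegral_eq_zero (measurableSet_Ioi.prod measurableSet_Ioi).compl fun p hp => ?_
  have : jointDensity ρ r p.1 p.2 = 0 :=
    if_neg fun h => hp ⟨h.1, h.1.trans h.2⟩
  simp [this]

theorem IsGeneralizedDickman.continuousOn_partialDensity {ρ : ℕ → ℝ → ℝ}
    (hρ : IsGeneralizedDickman ρ) (r : ℕ) {x : ℝ} (hx : 0 < x) :
    ContinuousOn (partialDensity ρ r x) (Set.Ici 0) := by
  unfold partialDensity
  refine ContinuousOn.mul (by fun_prop) ?_
  exact (hρ.continuousOn r).comp (by fun_prop) fun ν hν => div_nonneg hν hx.le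

theorem IsGeneralizedDickman.integrableOn_partialDensity {ρ : ℕ → ℝ → ℝ}
    (hρ : IsGeneralizedDickman ρ) (r : ℕ) {x y₁ y₂ : ℝ} (hx : 0 < x) (hy : 0 ≤ y₁) :
    IntegrableOn (partialDensity ρ r x) (Set.Ioc y₁ y₂) :=
  (((hρ.continuousOn_partialDensity r hx).mono fun _ h => hy.trans h.1).integrableOn_Icc).mono_set
    Set.Ioc_subset_Icc_self

theorem IsGeneralizedDickman.limitMeasure_real_box {ρ : ℕ → ℝ → ℝ} (hρ : IsGeneralizedDickman ρ)
    {r : ℕ} (hr : 1 ≤ r) {x₁ x₂ y₁ y₂ : ℝ} (h1 : 0 < x₁) (h12 : x₁ ≤ x₂) (hy : 0 ≤ y₁) :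
    (limitMeasure ρ r).real (Set.Ioc x₁ x₂ ×ˢ Set.Ioc y₁ y₂) =
      (∫ ν in Set.Ioc y₁ y₂, partialDensity ρ r x₂ ν) -
        ∫ ν in Set.Ioc y₁ y₂, partialDensity ρ r x₁ ν := by
  have i1 := hρ.integrableOn_partialDensity r (y₂ := y₂) h1 hy
  have i2 := hρ.integrableOn_partialDensity r (y₂ := y₂) (h1.trans_le h12) hy
  have hnn : ∀ ν ∈ Set.Ioc y₁ y₂, 0 ≤ partialDensity ρ r x₂ ν - partialDensity ρ r x₁ ν := by
    intro ν hν
    have hν0 : 0 < ν := hy.trans_lt hν.1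
    have hx₂ : 0 < x₂ := h1.trans_le h12
    obtain ⟨s, rfl⟩ := Nat.exists_eq_add_of_le' hr
    rw [sub_nonneg]
    unfold partialDensity
    gcongr
    exact hρ.antitoneOn_Ioi s (Set.mem_Ioi.2 (by positivity)) (Set.mem_Ioi.2 (by positivity))
      (by gcongr)
  rw [Measure.real, hρ.limitMeasure_box hr h1 h12 hy, ← integral_sub i2 i1,
    integral_eq_lintegral_of_nonneg_ae ((ae_restrict_iff' measurableSet_Ioc).2 (ae_of_all _ hnn))
      (i2.sub i1).aestronglyMeasurable]

/-! ### The local limit of the number of cyclic points -/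

/-- Counterpart of `1 - x ≤ exp (-x)`: `log (1 - x) ≥ -x / (1 - x)`, and this is at least `-x - 2x²`
because `x² (1 - 2x) ≥ 0`. -/
theorem exp_le_one_sub {x : ℝ} (h1 : x ≤ 1 / 2) :
    Real.exp (-x - 2 * x ^ 2) ≤ 1 - x := by
  have hpos : 0 < 1 - x := by linarith
  rw [← Real.le_log_iff_exp_le hpos]
  refine le_trans ?_ (Real.one_sub_inv_le_log_of_pos hpos)
  have h : 1 - (1 - x)⁻¹ = -x / (1 - x) := by field_simp; ring
  rw [h, le_div_iff₀ hpos]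
  nlinarith [mul_nonneg (sq_nonneg x) (by linarith : 0 ≤ 1 - 2 * x)]

theorem descFactorial_div_pow {n k : ℕ} (hn : 1 ≤ n) (hk : k ≤ n) :
    (n.descFactorial k : ℝ) / (n : ℝ) ^ k = ∏ i ∈ Finset.range k, (1 - (i : ℝ) / n) := by
  have hn0 : (n : ℝ) ≠ 0 := by positivity
  rw [Nat.descFactorial_eq_prod_range, Nat.cast_prod, ← Finset.card_range k, ← Finset.prod_const,
    Finset.card_range, ← Finset.prod_div_distrib]
  refine Finset.prod_congr rfl fun i hi => ?_
  rw [Finset.mem_range] at hi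
  rw [Nat.cast_sub (by omega)]
  field_simp

theorem sum_range_cast_div (n k : ℕ) :
    ∑ i ∈ Finset.range k, (i : ℝ) / n = k * (k - 1) / (2 * n) := by
  induction k with
  | zero => simp
  | succ k ih =>
    rw [Finset.sum_range_succ, ih]
    push_cast
    rcases eq_or_ne (n : ℝ) 0 with h | h
    · simp [h]
    · field_simp
      ring

theorem descFactorial_div_pow_le {n k : ℕ} (hn : 1 ≤ n) (hk : k ≤ n) :
    (n.descFactorial k : ℝ) / (n : ℝ) ^ k ≤ Real.exp (-(k * (k - 1) / (2 * n))) := by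
  rw [descFactorial_div_pow hn hk, ← sum_range_cast_div, ← Finset.sum_neg_distrib, Real.exp_sum]
  refine Finset.prod_le_prod (fun i hi => ?_) fun i hi => ?_
  · rw [Finset.mem_range] at hi
    rw [sub_nonneg, div_le_one (by positivity)]
    exact_mod_cast (hi.le.trans hk)
  · have := Real.add_one_le_exp (-((i : ℝ) / n))
    linarith

theorem le_descFactorial_div_pow {n k : ℕ} (hn : 1 ≤ n) (hk : 2 * k ≤ n) :
    Real.exp (-(k * (k - 1) / (2 * n)) - 2 * (k : ℝ) ^ 3 / n ^ 2) ≤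
      (n.descFactorial k : ℝ) / (n : ℝ) ^ k := by
  have hn0 : (0 : ℝ) < n := by positivity
  rw [descFactorial_div_pow hn (by omega)]
  have h1 : ∏ i ∈ Finset.range k, Real.exp (-((i : ℝ) / n) - 2 * ((i : ℝ) / n) ^ 2) ≤
      ∏ i ∈ Finset.range k, (1 - (i : ℝ) / n) := by
    refine Finset.prod_le_prod (fun i _ => (Real.exp_nonneg _)) fun i hi => ?_
    rw [Finset.mem_range] at hi
    refine exp_le_one_sub ?_
    rw [div_le_iff₀ hn0]
    have : (2 * i : ℝ) ≤ n := by exact_mod_cast (by omega : 2 * i ≤ n)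
    linarith
  refine le_trans ?_ h1
  rw [← Real.exp_sum, Real.exp_le_exp, Finset.sum_sub_distrib, Finset.sum_neg_distrib,
    sum_range_cast_div]
  gcongr
  calc ∑ i ∈ Finset.range k, 2 * ((i : ℝ) / n) ^ 2
      ≤ ∑ i ∈ Finset.range k, 2 * ((k : ℝ) / n) ^ 2 := by
        refine Finset.sum_le_sum fun i hi => ?_
        rw [Finset.mem_range] at hi
        gcongr
    _ = _ := by
        rw [Finset.sum_const, Finset.card_range, nsmul_eq_mul]
        field_simp

theorem tendsto_sqrt_natCast : Tendsto (fun n : ℕ => √(n : ℝ)) atTop atTop :=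
  Real.tendsto_sqrt_atTop.comp tendsto_natCast_atTop_atTop

/-- The product of the factors `1 - i/n` is squeezed between exponentials whose exponents differ
from `-k²/(2n)` by terms of order `k/n` and `k³/n²`, which vanish for `k` of order `√n`. -/
theorem tendsto_descFactorial_div_pow {k : ℕ → ℕ} {ν : ℝ}
    (hk : Tendsto (fun n : ℕ => (k n : ℝ) / √(n : ℝ)) atTop (𝓝 ν)) :
    Tendsto (fun n : ℕ => (n.descFactorial (k n) : ℝ) / (n : ℝ) ^ (k n)) atTop
      (𝓝 (Real.exp (-ν ^ 2 / 2))) := by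
  have hinv : Tendsto (fun n : ℕ => (√(n : ℝ))⁻¹) atTop (𝓝 0) :=
    tendsto_inv_atTop_zero.comp tendsto_sqrt_natCast
  have he1 : Tendsto (fun n : ℕ => -((k n : ℝ) * (k n - 1) / (2 * n))) atTop (𝓝 (-ν ^ 2 / 2)) := by
    have h := (((hk.pow 2).sub (hk.mul hinv)).div_const 2).neg
    rw [mul_zero, sub_zero, ← neg_div] at h
    refine h.congr' ?_
    filter_upwards [eventually_ge_atTop 1] with n hn
    have hs : 0 < √(n : ℝ) := Real.sqrt_pos.2 (by exact_mod_cast hn)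
    have hsq : 2 * (n : ℝ) = 2 * √(n : ℝ) ^ 2 := by rw [Real.sq_sqrt (Nat.cast_nonneg n)]
    rw [hsq]
    field_simp
  have he2 : Tendsto (fun n : ℕ => -((k n : ℝ) * (k n - 1) / (2 * n)) - 2 * (k n : ℝ) ^ 3 / n ^ 2)
      atTop (𝓝 (-ν ^ 2 / 2)) := by
    have h := he1.sub (((hk.pow 3).mul hinv).const_mul 2)
    rw [mul_zero, mul_zero, sub_zero] at h
    refine h.congr' ?_
    filter_upwards [eventually_ge_atTop 1] with n hn
    have hs : 0 < √(n : ℝ) := Real.sqrt_pos.2 (by exact_mod_cast hn)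
    have hsq : (n : ℝ) ^ 2 = √(n : ℝ) ^ 4 := by
      rw [show √(n : ℝ) ^ 4 = (√(n : ℝ) ^ 2) ^ 2 by ring, Real.sq_sqrt (Nat.cast_nonneg n)]
    rw [hsq]
    field_simp
  have hsmall : ∀ᶠ n in atTop, 2 * k n ≤ n ∧ 1 ≤ n := by
    have h := hk.mul hinv
    rw [mul_zero] at h
    filter_upwards [h.eventually_lt_const (show (0 : ℝ) < 1 / 2 by norm_num),
      eventually_ge_atTop 1] with n h1 hn
    refine ⟨?_, hn⟩
    have hn0 : (0 : ℝ) < n := by exact_mod_cast hn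
    have h2 : (k n : ℝ) / √(n : ℝ) * (√(n : ℝ))⁻¹ = k n / n := by
      rw [div_mul_eq_mul_div, ← div_eq_mul_inv, div_div, Real.mul_self_sqrt hn0.le]
    rw [h2, div_lt_iff₀ hn0] at h1
    have : (2 * k n : ℝ) ≤ n := by linarith
    exact_mod_cast this
  refine tendsto_of_tendsto_of_tendsto_of_le_of_le'
    ((Real.continuous_exp.tendsto _).comp he2) ((Real.continuous_exp.tendsto _).comp he1) ?_ ?_
  · filter_upwards [hsmall] with n hn
    exact le_descFactorial_div_pow hn.2 hn.1
  · filter_upwards [hsmall] with n hn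
    exact descFactorial_div_pow_le hn.2 (by omega)

theorem sqrt_mul_cyclicProb {n : ℕ} (hn : 1 ≤ n) (k : ℕ) :
    √(n : ℝ) * cyclicProb n k =
      (k : ℝ) / √(n : ℝ) * ((n.descFactorial k : ℝ) / (n : ℝ) ^ k) := by
  have hn0 : (0 : ℝ) < n := by exact_mod_cast hn
  have hs : 0 < √(n : ℝ) := Real.sqrt_pos.2 hn0
  have h2 : (n : ℝ) = √(n : ℝ) * √(n : ℝ) := (Real.mul_self_sqrt hn0.le).symm
  rw [cyclicProb, pow_succ]
  field_simp
  rw [sq, ← h2]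
  ring

theorem cyclicProb_nonneg (n k : ℕ) : 0 ≤ cyclicProb n k := by unfold cyclicProb; positivity

theorem sqrt_mul_cyclicProb_le {n : ℕ} (hn : 1 ≤ n) (k : ℕ) :
    √(n : ℝ) * cyclicProb n k ≤ k / √(n : ℝ) := by
  rw [sqrt_mul_cyclicProb hn]
  have hn0 : (0 : ℝ) < n := by exact_mod_cast hn
  refine mul_le_of_le_one_right (by positivity) ?_
  rw [div_le_one (by positivity)]
  exact_mod_cast Nat.descFactorial_le_pow n k

/-! ### Sums over `k` as integrals -/

/-- The step function on the scale `1 / s` whose integral is `∑ k ∈ Ioc A B, c k`. -/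
noncomputable def stepFunction (s : ℝ) (A B : ℕ) (c : ℕ → ℝ) (ν : ℝ) : ℝ :=
  if ⌈ν * s⌉₊ ∈ Finset.Ioc A B then s * c ⌈ν * s⌉₊ else 0

theorem stepFunction_eq_sum (s : ℝ) (hs : 0 < s) (A B : ℕ) (c : ℕ → ℝ) :
    stepFunction s A B c = fun ν => ∑ k ∈ Finset.Ioc A B,
      (Set.Ioc (((k : ℝ) - 1) / s) (k / s)).indicator (fun _ => s * c k) ν := by
  ext ν
  have h : ∀ k ∈ Finset.Ioc A B,
      (Set.Ioc (((k : ℝ) - 1) / s) (k / s)).indicator (fun _ => s * c k) ν =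
        if ⌈ν * s⌉₊ = k then s * c k else 0 := by
    intro k hk
    rw [Finset.mem_Ioc] at hk
    rw [Set.indicator_apply]
    refine if_congr ?_ rfl rfl
    rw [Set.mem_Ioc, div_lt_iff₀ hs, le_div_iff₀ hs, Nat.ceil_eq_iff (by omega),
      Nat.cast_sub (by omega), Nat.cast_one]
  rw [Finset.sum_congr rfl h, Finset.sum_ite_eq, stepFunction]

theorem measurable_stepFunction {s : ℝ} (hs : 0 < s) (A B : ℕ) (c : ℕ → ℝ) :
    Measurable (stepFunction s A B c) := by
  rw [stepFunction_eq_sum s hs]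
  exact Finset.measurable_fun_sum _ fun k _ => measurable_const.indicator measurableSet_Ioc

theorem integral_stepFunction {s : ℝ} (hs : 0 < s) (A B : ℕ) (c : ℕ → ℝ) :
    ∫ ν, stepFunction s A B c ν = ∑ k ∈ Finset.Ioc A B, c k := by
  rw [stepFunction_eq_sum s hs, integral_finsetSum]
  · refine Finset.sum_congr rfl fun k _ => ?_
    rw [integral_indicator measurableSet_Ioc, setIntegral_const, Real.volume_real_Ioc_of_le
      (by gcongr; linarith), smul_eq_mul]
    field_simp
    ring
  · intro k _
    exact (integrable_indicator_iff measurableSet_Ioc).2 (integrableOn_const (by simp))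

/-- The sum is the integral of a step function with `k = ⌈ν√n⌉`. Pointwise `√n * cyclicProb` tends
to the Rayleigh density and `permProb` to `ρ r (ν / x)`; the bound `√n * cyclicProb n k ≤ k / √n ≤
y₂` gives domination on a bounded window. -/
theorem IsGeneralizedDickman.tendsto_sum {ρ : ℕ → ℝ → ℝ} (hρ : IsGeneralizedDickman ρ)
    (r : ℕ) {x y₁ y₂ : ℝ} (hx : 0 < x) (hy : 0 ≤ y₁) :
    Tendsto (fun n : ℕ => ∑ k ∈ Finset.Ioc ⌊y₁ * √(n : ℝ)⌋₊ ⌊y₂ * √(n : ℝ)⌋₊,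
      cyclicProb n k * permProb r ⌊x * √(n : ℝ)⌋₊ k) atTop
      (𝓝 (∫ ν in Set.Ioc y₁ y₂, partialDensity ρ r x ν)) := by
  set F : ℕ → ℝ → ℝ := fun n => stepFunction √(n : ℝ) ⌊y₁ * √(n : ℝ)⌋₊ ⌊y₂ * √(n : ℝ)⌋₊
    fun k => cyclicProb n k * permProb r ⌊x * √(n : ℝ)⌋₊ k with hF
  have hpos : ∀ n : ℕ, 1 ≤ n → 0 < √(n : ℝ) := fun n hn => Real.sqrt_pos.2 (by exact_mod_cast hn)
  have key : Tendsto (fun n => ∫ ν, F n ν) atTop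
      (𝓝 (∫ ν, (Set.Ioc y₁ y₂).indicator (partialDensity ρ r x) ν)) := by
    refine tendsto_integral_filter_of_dominated_convergence
      ((Set.Ioc 0 y₂).indicator fun _ => y₂) ?_ ?_ ?_ ?_
    · filter_upwards [eventually_ge_atTop 1] with n hn
      exact (measurable_stepFunction (hpos n hn) _ _ _).aestronglyMeasurable
    · filter_upwards [eventually_ge_atTop 1] with n hn
      refine ae_of_all _ fun ν => ?_
      have hs := hpos n hn
      simp only [hF, stepFunction]
      split_ifs with hk
      · rw [Finset.mem_Ioc] at hk
        have hk0 : ⌈ν * √(n : ℝ)⌉₊ ≠ 0 := by omega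
        have hy2 : (⌈ν * √(n : ℝ)⌉₊ : ℝ) ≤ y₂ * √(n : ℝ) := by
          rw [← Nat.le_floor_iff' hk0]
          exact hk.2
        have hν : 0 < ν := by
          have := Nat.ceil_pos.1 (Nat.pos_of_ne_zero hk0)
          exact pos_of_mul_pos_left this hs.le
        have hνy : ν ≤ y₂ := le_of_mul_le_mul_right ((Nat.le_ceil _).trans hy2) hs
        rw [Set.indicator_of_mem (show ν ∈ Set.Ioc 0 y₂ from ⟨hν, hνy⟩), ← mul_assoc, norm_mul,
          Real.norm_of_nonneg (mul_nonneg hs.le (cyclicProb_nonneg _ _)),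
          Real.norm_of_nonneg (permProb_nonneg _ _ _)]
        refine (mul_le_of_le_one_right (mul_nonneg hs.le (cyclicProb_nonneg _ _))
          (permProb_le_one _ _ _)).trans ((sqrt_mul_cyclicProb_le hn _).trans ?_)
        rwa [div_le_iff₀ hs]
      · rw [norm_zero]
        refine Set.indicator_nonneg (fun ν hν => hν.1.le.trans hν.2) _
    · exact (integrable_indicator_iff measurableSet_Ioc).2 (integrableOn_const (by simp))
    -- At the two endpoints rounding may put `⌈ν√n⌉` on the wrong side of the window; elsewhere the
    -- distance to the endpoint, times `√n`, eventually exceeds the rounding error.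
    · have hae : ∀ᵐ ν : ℝ, ν ≠ y₁ ∧ ν ≠ y₂ := by
        have h1 : ∀ᵐ ν : ℝ, ν ≠ y₁ := Measure.ae_ne volume y₁
        have h2 : ∀ᵐ ν : ℝ, ν ≠ y₂ := Measure.ae_ne volume y₂
        filter_upwards [h1, h2] with ν a b using ⟨a, b⟩
      filter_upwards [hae] with ν hν
      have hgrow : ∀ {a b : ℝ}, a < b → ∀ᶠ n : ℕ in atTop, a * √(n : ℝ) + 1 ≤ b * √(n : ℝ) := by
        intro a b hab
        filter_upwards [(tendsto_sqrt_natCast.const_mul_atTop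
          (sub_pos.2 hab)).eventually_ge_atTop 1] with n hn
        linarith
      rcases hν.1.lt_or_gt with h1 | h1
      · rw [Set.indicator_of_notMem fun h => h1.not_gt h.1]
        refine tendsto_const_nhds.congr' ?_
        filter_upwards [hgrow h1, eventually_ge_atTop 1] with n hn hn1
        refine (if_neg ?_).symm
        rw [Finset.mem_Ioc, not_and_or, not_lt]
        left
        refine Nat.le_floor ?_
        rcases le_or_gt 0 ν with h0 | h0
        · exact (Nat.ceil_lt_add_one (by positivity)).le.trans hn
        · rw [Nat.ceil_eq_zero.2 (mul_nonpos_of_nonpos_of_nonneg h0.le (Real.sqrt_nonneg _))]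
          simp only [Nat.cast_zero]
          positivity
      rcases hν.2.lt_or_gt with h2 | h2
      · rw [Set.indicator_of_mem (show ν ∈ Set.Ioc y₁ y₂ from ⟨h1, h2.le⟩)]
        have hν0 : 0 < ν := hy.trans_lt h1
        have hk : Tendsto (fun n : ℕ => (⌈ν * √(n : ℝ)⌉₊ : ℝ) / √(n : ℝ)) atTop (𝓝 ν) :=
          (tendsto_nat_ceil_mul_div_atTop hν0.le).comp tendsto_sqrt_natCast
        have hm : Tendsto (fun n : ℕ => (⌊x * √(n : ℝ)⌋₊ : ℝ) / √(n : ℝ)) atTop (𝓝 x) :=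
          (tendsto_nat_floor_mul_div_atTop hx.le).comp tendsto_sqrt_natCast
        have hmtop : Tendsto (fun n : ℕ => ⌊x * √(n : ℝ)⌋₊) atTop atTop :=
          tendsto_nat_floor_atTop.comp (tendsto_sqrt_natCast.const_mul_atTop hx)
        have hkm : Tendsto (fun n : ℕ => (⌈ν * √(n : ℝ)⌉₊ : ℝ) / (⌊x * √(n : ℝ)⌋₊ : ℝ)) atTop
            (𝓝 (ν / x)) := by
          refine (hk.div hm hx.ne').congr' ?_
          filter_upwards [eventually_ge_atTop 1] with n hn
          exact div_div_div_cancel_right₀ (hpos n hn).ne' _ _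
        have hlim := (hk.mul (tendsto_descFactorial_div_pow hk)).mul
          (hρ.tendsto_permProb r (div_pos hν0 hx) hmtop hkm)
        refine hlim.congr' ?_
        filter_upwards [hgrow h2, eventually_ge_atTop 1] with n hn hn1
        have hs := hpos n hn1
        simp only [hF, stepFunction]
        rw [if_pos, ← mul_assoc, sqrt_mul_cyclicProb hn1]
        rw [Finset.mem_Ioc]
        constructor
        · rw [Nat.floor_lt (by positivity)]
          exact (mul_lt_mul_of_pos_right h1 hs).trans_le (Nat.le_ceil _)
        · exact Nat.le_floor ((Nat.ceil_lt_add_one (by positivity)).le.trans hn)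
      · rw [Set.indicator_of_notMem fun h => h2.not_ge h.2]
        refine tendsto_const_nhds.congr' ?_
        filter_upwards [eventually_ge_atTop 1] with n hn
        refine (if_neg ?_).symm
        intro hmem
        rw [Finset.mem_Ioc] at hmem
        have hk0 : ⌈ν * √(n : ℝ)⌉₊ ≠ 0 := by omega
        have h3 := (Nat.le_floor_iff' hk0).1 hmem.2
        exact h2.not_ge (le_of_mul_le_mul_right ((Nat.le_ceil _).trans h3) (hpos n hn))
  rw [integral_indicator measurableSet_Ioc] at key
  refine key.congr' ?_
  filter_upwards [eventually_ge_atTop 1] with n hn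
  exact integral_stepFunction (hpos n hn) _ _ _

/-! ### Convergence in distribution -/

theorem uniformMapping_real {n : ℕ} (s : Finset (Fin n → Fin n)) :
    (uniformMapping n).real (s : Set (Fin n → Fin n)) = s.card / (n : ℝ) ^ n := by
  rw [uniformMapping, Measure.real, uniformOn_univ, Measure.count_apply_finset]
  simp

open scoped Classical in
theorem uniformMapping_real_le {r : ℕ} (hr : 1 ≤ r) {n : ℕ} (hn : 1 ≤ n) (m A B : ℕ) :
    (uniformMapping n).real {φ | rthLongestCycle r φ ≤ m ∧ (cyclicPoints φ).card ∈ Finset.Ioc A B} =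
      ∑ k ∈ Finset.Ioc A B, cyclicProb n k * permProb r m k := by
  have h1 : {φ : Fin n → Fin n | rthLongestCycle r φ ≤ m ∧
      (cyclicPoints φ).card ∈ Finset.Ioc A B} =
      ((Finset.univ.filter fun φ : Fin n → Fin n => rthLongestCycle r φ ≤ m ∧
        (cyclicPoints φ).card ∈ Finset.Ioc A B : Finset _) : Set (Fin n → Fin n)) := by
    ext φ; simp
  rw [h1, uniformMapping_real, Finset.card_eq_sum_card_fiberwise
    (f := fun φ => (cyclicPoints φ).card) (t := Finset.Ioc A B) fun φ hφ => by
      simpa using (Finset.mem_filter.1 hφ).2.2, Nat.cast_sum, Finset.sum_div]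
  refine Finset.sum_congr rfl fun k hk => ?_
  rw [← card_rthLongestCycle_le hr hn m k, Finset.filter_filter]
  congr 3
  ext φ
  simp only [Finset.mem_filter, Finset.mem_univ, true_and]
  constructor
  · rintro ⟨⟨h, -⟩, h'⟩
    exact ⟨h', h⟩
  · rintro ⟨h', h⟩
    exact ⟨⟨h, by rw [h']; exact hk⟩, h'⟩

theorem scaledPair_mem_box {r n : ℕ} (hn : 1 ≤ n) {x₁ x₂ y₁ y₂ : ℝ} (hx₁ : 0 ≤ x₁) (h12 : x₁ ≤ x₂)
    (hy : 0 ≤ y₁) (hy12 : y₁ ≤ y₂) (φ : Fin n → Fin n) :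
    scaledPair r n φ ∈ Set.Ioc x₁ x₂ ×ˢ Set.Ioc y₁ y₂ ↔
      (rthLongestCycle r φ ≤ ⌊x₂ * √(n : ℝ)⌋₊ ∧
        (cyclicPoints φ).card ∈ Finset.Ioc ⌊y₁ * √(n : ℝ)⌋₊ ⌊y₂ * √(n : ℝ)⌋₊) ∧
      ¬(rthLongestCycle r φ ≤ ⌊x₁ * √(n : ℝ)⌋₊ ∧
        (cyclicPoints φ).card ∈ Finset.Ioc ⌊y₁ * √(n : ℝ)⌋₊ ⌊y₂ * √(n : ℝ)⌋₊) := by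
  have hs : 0 < √(n : ℝ) := Real.sqrt_pos.2 (by exact_mod_cast hn)
  have hx₂ := hx₁.trans h12
  have hy₂ := hy.trans hy12
  rw [scaledPair, Set.mem_prod, Set.mem_Ioc, Set.mem_Ioc, Finset.mem_Ioc,
    Nat.le_floor_iff (by positivity), Nat.le_floor_iff (by positivity),
    Nat.le_floor_iff (by positivity), Nat.floor_lt (by positivity)]
  simp only [lt_div_iff₀ hs, div_le_iff₀ hs]
  rw [← not_le]
  tauto

theorem uniformMapping_box {r : ℕ} (hr : 1 ≤ r) {n : ℕ} (hn : 1 ≤ n) {x₁ x₂ y₁ y₂ : ℝ}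
    (hx₁ : 0 ≤ x₁) (h12 : x₁ ≤ x₂) (hy : 0 ≤ y₁) (hy12 : y₁ ≤ y₂) :
    (uniformMapping n).real (scaledPair r n ⁻¹' (Set.Ioc x₁ x₂ ×ˢ Set.Ioc y₁ y₂)) =
      (∑ k ∈ Finset.Ioc ⌊y₁ * √(n : ℝ)⌋₊ ⌊y₂ * √(n : ℝ)⌋₊,
        cyclicProb n k * permProb r ⌊x₂ * √(n : ℝ)⌋₊ k) -
      ∑ k ∈ Finset.Ioc ⌊y₁ * √(n : ℝ)⌋₊ ⌊y₂ * √(n : ℝ)⌋₊,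
        cyclicProb n k * permProb r ⌊x₁ * √(n : ℝ)⌋₊ k := by
  rw [← uniformMapping_real_le hr hn, ← uniformMapping_real_le hr hn, ← measureReal_sdiff]
  · congr 1
    ext φ
    exact scaledPair_mem_box hn hx₁ h12 hy hy12 φ
  · rintro φ ⟨h1, h2⟩
    refine ⟨h1.trans ?_, h2⟩
    gcongr
  · exact (Set.toFinite _).measurableSet

/-- Weak convergence of probability measures follows from convergence on a π-system that contains
small neighbourhoods of every point of a set of full measure. -/
theorem tendsto_probabilityMeasure_of_isPiSystem {Ω ι : Type*} [MeasurableSpace Ω]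
    [TopologicalSpace Ω] [SecondCountableTopology Ω] [OpensMeasurableSpace Ω] {S : Set (Set Ω)}
    (hS : IsPiSystem S) {μ : ι → ProbabilityMeasure Ω} {ν : ProbabilityMeasure Ω} {l : Filter ι}
    [l.IsCountablyGenerated] (hmeas : ∀ s ∈ S, MeasurableSet s) {Q : Set Ω}
    (hνQ : (ν : Measure Ω) Qᶜ = 0)
    (h : ∀ u : Set Ω, IsOpen u → ∀ x ∈ u ∩ Q, ∃ s ∈ S, s ∈ 𝓝 x ∧ s ⊆ u)
    (h' : ∀ s ∈ S, Tendsto (fun i => μ i s) l (𝓝 (ν s))) :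
    Tendsto μ l (𝓝 ν) := by
  rcases l.eq_or_neBot with rfl | hl
  · simp
  -- Portmanteau theorem: a lower bound on open sets is enough. By second countability, `G ∩ Q` is
  -- covered by countably many members of `S` inside `G`. Finitely many of them carry mass above
  -- `a`, and convergence on finite unions follows from the π-system property.
  apply tendsto_of_forall_isOpen_le_liminf
  intro G hG
  refine (le_liminf_iff (isCoboundedUnder_ge_of_le (x := 1) l (by simp)) (by isBoundedDefault)).2
    fun a ha => ?_
  have hGQ : ν (G ∩ Q) = ν G := by
    simp only [ProbabilityMeasure.coeFn_def, measure_inter_conull hνQ]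
  rw [← hGQ] at ha
  have hex : ∀ x : ↥(G ∩ Q), ∃ s ∈ S, s ∈ 𝓝 (x : Ω) ∧ s ⊆ G := fun x => h G hG x x.2
  choose s hsS hs_nhds hsG using hex
  obtain ⟨T, hTc, hT⟩ := TopologicalSpace.isOpen_iUnion_countable (fun i => interior (s i))
    fun i => isOpen_interior
  have hcov : G ∩ Q ⊆ ⋃ i ∈ T, s i := fun x hx => by
    have h1 : x ∈ ⋃ i ∈ T, interior (s i) := by
      rw [hT]
      exact Set.mem_iUnion.2 ⟨⟨x, hx⟩, mem_interior_iff_mem_nhds.2 (hs_nhds ⟨x, hx⟩)⟩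
    obtain ⟨i, hi, hxi⟩ := Set.mem_iUnion₂.1 h1
    exact Set.mem_iUnion₂.2 ⟨i, hi, interior_subset hxi⟩
  rcases T.eq_empty_or_nonempty with rfl | hTne
  · have : G ∩ Q = ∅ := by simpa using hcov
    simp [this] at ha
  obtain ⟨f, hf⟩ := hTc.exists_eq_range hTne
  have hlim : Tendsto (fun i => ν (Set.accumulate (fun j => s (f j)) i)) atTop
      (𝓝 (ν (⋃ j, s (f j)))) :=
    (ENNReal.tendsto_toNNReal_iff (by simp) (by simp)).2 tendsto_measure_iUnion_accumulate
  have hlt : a < ν (⋃ j, s (f j)) := ha.trans_le (ProbabilityMeasure.apply_mono _ (by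
    rwa [hf, Set.biUnion_range] at hcov))
  obtain ⟨N, hN⟩ := ((tendsto_order.1 hlim).1 a hlt).exists
  classical
  have hU : Set.accumulate (fun j => s (f j)) N =
      ⋃ t ∈ (Finset.range (N + 1)).image (fun j => s (f j)), t := by
    simp [Set.accumulate_def]
  rw [hU] at hN
  have hconv := hS.tendsto_probabilityMeasure_biUnion
    (t := (Finset.range (N + 1)).image fun j => s (f j)) (by
      intro t ht
      obtain ⟨j, -, rfl⟩ := Finset.mem_image.1 ht
      exact hsS _) hmeas h'
  filter_upwards [(tendsto_order.1 hconv).1 a hN] with i hi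
  refine hi.trans_le (ProbabilityMeasure.apply_mono _ ?_)
  refine Set.iUnion₂_subset fun t ht => ?_
  obtain ⟨j, -, rfl⟩ := Finset.mem_image.1 ht
  exact hsG _

/-- The half-open boxes in the open positive quadrant. -/
def positiveBoxes : Set (Set (ℝ × ℝ)) :=
  {s | ∃ x₁ x₂ y₁ y₂ : ℝ, 0 < x₁ ∧ x₁ < x₂ ∧ 0 < y₁ ∧ y₁ < y₂ ∧
    s = Set.Ioc x₁ x₂ ×ˢ Set.Ioc y₁ y₂}

theorem isPiSystem_positiveBoxes : IsPiSystem positiveBoxes := by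
  rintro _ ⟨x₁, x₂, y₁, y₂, hx, -, hy, -, rfl⟩ _ ⟨x₁', x₂', y₁', y₂', -, -, -, -, rfl⟩ hne
  rw [Set.prod_inter_prod, Set.Ioc_inter_Ioc, Set.Ioc_inter_Ioc] at hne ⊢
  obtain ⟨p, hp1, hp2⟩ := hne
  exact ⟨_, _, _, _, lt_max_of_lt_left hx, hp1.1.trans_le hp1.2, lt_max_of_lt_left hy,
    hp2.1.trans_le hp2.2, rfl⟩

theorem exists_positiveBox_mem_nhds {u : Set (ℝ × ℝ)} (hu : IsOpen u) {p : ℝ × ℝ}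
    (hp : p ∈ u ∩ Set.Ioi 0 ×ˢ Set.Ioi 0) : ∃ s ∈ positiveBoxes, s ∈ 𝓝 p ∧ s ⊆ u := by
  obtain ⟨hpu, hp1, hp2⟩ := hp
  obtain ⟨ε, hε, hball⟩ := Metric.isOpen_iff.1 hu p hpu
  rw [Set.mem_Ioi] at hp1 hp2
  set δ := min (ε / 2) (min (p.1 / 2) (p.2 / 2)) with hδ
  have hδ0 : 0 < δ := by positivity
  have hδε : δ ≤ ε / 2 := min_le_left _ _
  have hδ1 : δ ≤ p.1 / 2 := (min_le_right _ _).trans (min_le_left _ _)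
  have hδ2 : δ ≤ p.2 / 2 := (min_le_right _ _).trans (min_le_right _ _)
  refine ⟨_, ⟨p.1 - δ, p.1 + δ, p.2 - δ, p.2 + δ, by linarith, by linarith, by linarith,
    by linarith, rfl⟩, ?_, ?_⟩
  · exact prod_mem_nhds (Ioc_mem_nhds (by linarith) (by linarith))
      (Ioc_mem_nhds (by linarith) (by linarith))
  · rintro ⟨x, y⟩ ⟨hx, hy⟩
    refine hball ?_
    rw [Metric.mem_ball, Prod.dist_eq, max_lt_iff, Real.dist_eq, Real.dist_eq, abs_lt, abs_lt]
    simp only [Set.mem_Ioc] at hx hy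
    exact ⟨⟨by linarith, by linarith⟩, by linarith, by linarith⟩

/-- The probability of a box is a difference of two of the sums treated above. Maps with fewer than
`r` cycles fall outside the open quadrant; they need no separate estimate because the limit has full
mass inside it. -/
theorem IsGeneralizedDickman.tendstoInDistribution {ρ : ℕ → ℝ → ℝ} (hρ : IsGeneralizedDickman ρ)
    {r : ℕ} (hr : 1 ≤ r) (μ : ProbabilityMeasure (ℝ × ℝ))
    (hμ : (μ : Measure (ℝ × ℝ)) = limitMeasure ρ r) :
    TendstoInDistribution (fun n : ℕ => scaledPair r n) atTop (id : ℝ × ℝ → ℝ × ℝ)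
      (fun n : ℕ => uniformMapping n) (μ : Measure (ℝ × ℝ)) := by
  have hm : ∀ n, Measurable (scaledPair r n) := fun n => measurable_of_finite _
  refine ⟨fun n => (hm n).aemeasurable, aemeasurable_id, ?_⟩
  refine tendsto_probabilityMeasure_of_isPiSystem isPiSystem_positiveBoxes ?_
    (Q := Set.Ioi 0 ×ˢ Set.Ioi 0) ?_
    (fun u hu p hp => exists_positiveBox_mem_nhds hu hp) ?_
  · rintro _ ⟨x₁, x₂, y₁, y₂, -, -, -, -, rfl⟩
    exact measurableSet_Ioc.prod measurableSet_Ioc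
  · rw [ProbabilityMeasure.coe_mk, Measure.map_id, hμ]
    exact limitMeasure_compl_quadrant ρ r
  · rintro _ ⟨x₁, x₂, y₁, y₂, hx, hx12, hy, hy12, rfl⟩
    have hbox : MeasurableSet (Set.Ioc x₁ x₂ ×ˢ Set.Ioc y₁ y₂) :=
      measurableSet_Ioc.prod measurableSet_Ioc
    rw [← NNReal.tendsto_coe]
    have hlim := (hρ.tendsto_sum r (y₂ := y₂) (hx.trans hx12) hy.le).sub
      (hρ.tendsto_sum r (y₂ := y₂) hx hy.le)
    rw [← hρ.limitMeasure_real_box hr hx hx12.le hy.le] at hlim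
    have hR : (limitMeasure ρ r).real (Set.Ioc x₁ x₂ ×ˢ Set.Ioc y₁ y₂) =
        (Measure.map id (μ : Measure (ℝ × ℝ))).real (Set.Ioc x₁ x₂ ×ˢ Set.Ioc y₁ y₂) := by
      rw [Measure.map_id, hμ]
    rw [hR] at hlim
    refine hlim.congr' ?_
    filter_upwards [eventually_ge_atTop 1] with n hn
    rw [← uniformMapping_box hr hn hx.le hx12.le hy.le hy12.le, ← map_measureReal_apply (hm n) hbox]
    rfl

end RandomMapping

theorem mainTheorem2 :
    (∃! ρ : ℕ → ℝ → ℝ, RandomMapping.IsGeneralizedDickman ρ) ∧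
    ∀ ρ : ℕ → ℝ → ℝ, RandomMapping.IsGeneralizedDickman ρ → ∀ r : ℕ, 2 ≤ r →
      (Measurable fun p : ℝ × ℝ => RandomMapping.jointDensity ρ r p.1 p.2) ∧
      (∀ l ν : ℝ, 0 ≤ RandomMapping.jointDensity ρ r l ν) ∧
      ∃ μ : ProbabilityMeasure (ℝ × ℝ),
        (μ : Measure (ℝ × ℝ)) = (volume : Measure (ℝ × ℝ)).withDensity
          (fun p => ENNReal.ofReal (RandomMapping.jointDensity ρ r p.1 p.2)) ∧
        TendstoInDistribution (fun n : ℕ => RandomMapping.scaledPair r n) atTop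
          (id : ℝ × ℝ → ℝ × ℝ) (fun n : ℕ => RandomMapping.uniformMapping n)
          (μ : Measure (ℝ × ℝ)) := by
  refine ⟨RandomMapping.existsUnique_isGeneralizedDickman, fun ρ hρ r hr => ?_⟩
  have hr' : 1 ≤ r := by omega
  exact ⟨hρ.measurable_jointDensity r, hρ.jointDensity_nonneg hr',
    ⟨RandomMapping.limitMeasure ρ r, hρ.isProbabilityMeasure_limitMeasure hr'⟩, rfl,
    hρ.tendstoInDistribution hr' _ rfl⟩
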